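/- Let $n\ge 2$ and let $\mathbb{S}^{n-1}$ be the unit sphere of $\mathbb{R}^n$ with surface measure $\mathrm{d}m$. For $\alpha>0$ consider the Onsager functional with Maier–Saupe potential $$\mathcal{A}[f]=\int_{\mathbb{S}^{n-1}}f\log f\,\mathrm{d}m+\frac{\alpha}{2}\int_{\mathbb{S}^{n-1}\times\mathbb{S}^{n-1}}\big(1-(m\cdot m')^2\big)f(m)f(m')\,\mathrm{d}m\,\mathrm{d}m'$$ on positive functions $f$ with $\int f\,\mathrm{d}m=1$. A critical point is such an $f$ for which $\log f(m)-\alpha\int(m\cdot m')^2f(m')\,\mathrm{d}m'$ is constant on $\mathbb{S}^{n-1}$. For a critical point $f$ and $\phi\in V:=\{\phi\in L^2(\mathbb{S}^{n-1}):\int\phi\,\mathrm{d}m=0\}$, the second variation is $$\mathcal{H}_f\phi=\frac{\phi}{f}-\alpha\int(m\cdot m')^2\phi(m')\,\mathrm{d}m'-\frac{1}{|\mathbb{S}^{n-1}|}\int_{\mathbb{S}^{n-1}}\Big(\frac{\phi}{f}-\alpha\int(m\cdot m')^2\phi(m')\,\mathrm{d}m'\Big)\mathrm{d}m .$$ The critical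 point $f$ is called stable if $\langle\mathcal{H}_f\phi,\phi\rangle_{L^2(\mathbb{S}^{n-1})}\ge 0$ for all $\phi\in V$, and unstable otherwise. For $1\le k\le n-1$, $\eta\in\mathbb{R}$ and $R\in O(n)$, let $P_km=(m_1,\dots,m_k,0,\dots,0)$ and $$h^{(k)}_{\eta,R}(m)=\frac{e^{\eta|P_kRm|^2}}{\int_{\mathbb{S}^{n-1}}e^{\eta|P_kRm'|^2}\,\mathrm{d}m'},\qquad \sigma_k(\eta)=\frac{(n-k)k\int_0^{\pi/2}e^{\eta\sin^2\theta}\,\mathrm{d}\mu_k^\theta}{2\int_0^{\pi/2}e^{\eta\sin^2\theta}\sin^2\theta\cos^2\theta\,\mathrm{d}\mu_k^\theta},$$ where $\mathrm{d}\mu_k^\theta=\sin^{k-1}\theta\cos^{n-k-1}\theta\,\mathrm{d}\theta$. (i) For every $\alpha>0$ the uniform density $h_0=1/|\mathbb{S}^{n-1}|$ is a critical point, and it is stable if and only if $\alpha\le\frac{n(n+2)}{2}$. (ii) If $2\le k\le\lfloor n/2\rfloor$, $\eta\neq0$, $R\in O(n)$ and $\alpha=\sigma_k(\eta)$, then $h^{(k)}_{\eta,R}$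 is a critical point and it is unstable. (iii) Let $n\ge3$. The function $\sigma_1$ attains its minimum over $\mathbb{R}$ at exactly one point $\eta_1^*$. If $\eta\ne0$, $R\in O(n)$ and $\alpha=\sigma_1(\eta)$, then $h^{(1)}_{\eta,R}$ is a critical point; it is stable when $\eta>\eta_1^*$ and unstable when $\eta<\eta_1^*$. -/

import Mathlib

open MeasureTheory Filter Topology

noncomputable section

namespace Onsager

/-- The unit sphere of `ℝⁿ`. -/
abbrev Sph (n : ℕ) : Type := Metric.sphere (0 : EuclideanSpace ℝ (Fin n)) 1

/-- The (unnormalized) surface measure of the unit sphere. -/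
abbrev surf (n : ℕ) : Measure (Sph n) :=
  (volume : Measure (EuclideanSpace ℝ (Fin n))).toSphere

/-- The squared dot product `(m · m')²` of two points of the sphere. -/
def dotSq {n : ℕ} (m m' : Sph n) : ℝ :=
  (inner ℝ (m : EuclideanSpace ℝ (Fin n)) (m' : EuclideanSpace ℝ (Fin n))) ^ 2

/-- The Onsager energy functional with Maier–Saupe interaction potential `1 - (m · m')²`. -/
def energy (n : ℕ) (α : ℝ) (f : Sph n → ℝ) : ℝ :=
  ∫ m, f m * Real.log (f m) ∂(surf n) +
    α / 2 * ∫ p : Sph n × Sph n, (1 - dotSq p.1 p.2) * f p.1 * f p.2 ∂((surf n).prod (surf n))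

/-- Critical points of the energy: positive probability densities that satisfy the
Euler–Lagrange equation `log f(m) - α ∫ (m · m')² f(m') dm' = const`. -/
def IsCriticalPoint (n : ℕ) (α : ℝ) (f : Sph n → ℝ) : Prop :=
  (∀ m, 0 < f m) ∧ ∫ m, f m ∂(surf n) = 1 ∧
    ∃ c : ℝ, ∀ m, Real.log (f m) - α * ∫ m', dotSq m m' * f m' ∂(surf n) = c

/-- The space of perturbations: square integrable functions on the sphere of mean zero. -/
def Perturbation (n : ℕ) (φ : Sph n → ℝ) : Prop :=
  MemLp φ 2 (surf n) ∧ ∫ m, φ m ∂(surf n) = 0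

/-- The unprojected second derivative `φ / f - α ∫ (m · m')² φ(m') dm'`. -/
def preHessian (n : ℕ) (α : ℝ) (f φ : Sph n → ℝ) (m : Sph n) : ℝ :=
  φ m / f m - α * ∫ m', dotSq m m' * φ m' ∂(surf n)

/-- The second variation `δ²A/δf²` of the energy at `f`, as an operator on perturbations of mean
zero (so that its values have mean zero). The theorem `energy_second_derivative` below verifies
that its quadratic form is the second derivative of the energy along `f + t φ`. -/
def hessian (n : ℕ) (α : ℝ) (f φ : Sph n → ℝ) (m : Sph n) : ℝ :=
  preHessian n α f φ m - ⨍ m', preHessian n α f φ m' ∂(surf n)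

/-- The quadratic form `⟨(δ²A/δf²) φ, φ⟩` in `L²` of the sphere. -/
def secondVariation (n : ℕ) (α : ℝ) (f φ : Sph n → ℝ) : ℝ :=
  ∫ m, hessian n α f φ m * φ m ∂(surf n)

/-- A critical point is stable if the second variation at it is nonnegative definite. -/
def IsStable (n : ℕ) (α : ℝ) (f : Sph n → ℝ) : Prop :=
  IsCriticalPoint n α f ∧ ∀ φ, Perturbation n φ → 0 ≤ secondVariation n α f φ

/-- A critical point is unstable if it is not stable. -/
def IsUnstable (n : ℕ) (α : ℝ) (f : Sph n → ℝ) : Prop :=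
  IsCriticalPoint n α f ∧ ¬ IsStable n α f

/-- The uniform density `1 / |S^{n-1}|`. -/
def h₀ (n : ℕ) : Sph n → ℝ := fun _ => 1 / (surf n).real Set.univ

/-- The projection `P_k (m₁, …, mₙ) = (m₁, …, m_k, 0, …, 0)`. -/
def proj {n : ℕ} (k : ℕ) (x : EuclideanSpace ℝ (Fin n)) : EuclideanSpace ℝ (Fin n) :=
  WithLp.toLp 2 fun i => if (i : ℕ) < k then x i else 0

/-- The density `h^{(k)}_{η,R}`, proportional to `exp (η |P_k R m|²)`; the elements `R` of `O(n)`
are the linear isometries of `ℝⁿ` onto itself. -/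
def h (n k : ℕ) (η : ℝ) (R : EuclideanSpace ℝ (Fin n) ≃ₗᵢ[ℝ] EuclideanSpace ℝ (Fin n)) :
    Sph n → ℝ :=
  fun m => Real.exp (η * ‖proj k (R m)‖ ^ 2) /
    ∫ m' : Sph n, Real.exp (η * ‖proj k (R m')‖ ^ 2) ∂(surf n)

/-- The function `σ_k` (for `1 ≤ k ≤ n - 1`), where `dμ_k = sin^{k-1} θ cos^{n-k-1} θ dθ`. -/
def sigma (n k : ℕ) (η : ℝ) : ℝ :=
  (((n : ℝ) - k) * k * ∫ θ in (0 : ℝ)..(Real.pi / 2),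
      Real.exp (η * Real.sin θ ^ 2) * (Real.sin θ ^ (k - 1) * Real.cos θ ^ (n - k - 1))) /
    (2 * ∫ θ in (0 : ℝ)..(Real.pi / 2),
      Real.exp (η * Real.sin θ ^ 2) * Real.sin θ ^ 2 * Real.cos θ ^ 2 *
        (Real.sin θ ^ (k - 1) * Real.cos θ ^ (n - k - 1)))

lemma continuous_dotSq {n : ℕ} : Continuous fun p : Sph n × Sph n => dotSq p.1 p.2 := by
  unfold dotSq
  fun_prop

lemma abs_dotSq_le {n : ℕ} (m m' : Sph n) : |dotSq m m'| ≤ 1 := by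
  have h1 := abs_real_inner_le_norm (m : EuclideanSpace ℝ (Fin n)) m'
  have e1 : ‖(m : EuclideanSpace ℝ (Fin n))‖ = 1 := by simp
  have e2 : ‖(m' : EuclideanSpace ℝ (Fin n))‖ = 1 := by simp
  rw [e1, e2, one_mul] at h1
  unfold dotSq
  rw [abs_pow]
  exact pow_le_one₀ (abs_nonneg _) h1

/-- A bounded measurable function is integrable for a finite measure. -/
lemma integrable_bdd {X : Type*} [MeasurableSpace X] {μ : Measure X} [IsFiniteMeasure μ]
    {g : X → ℝ} (hg : Measurable g) (C : ℝ) (hC : ∀ x, |g x| ≤ C) : Integrable g μ :=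
  Integrable.of_bound hg.aestronglyMeasurable C (Eventually.of_forall hC)

lemma entropy_derivs {X : Type*} [MeasurableSpace X] {μ : Measure X} [IsFiniteMeasure μ]
    {f φ : X → ℝ} (hf : Measurable f) (hφ : Measurable φ) {a b C : ℝ} (ha : 0 < a)
    (hfa : ∀ m, a ≤ f m) (hfb : ∀ m, f m ≤ b) (hC : ∀ m, |φ m| ≤ C) (hC0 : 0 < C) :
    (∀ t ∈ Metric.ball (0 : ℝ) (a / (4 * C)),
      HasDerivAt (fun t : ℝ => ∫ m, (f m + t * φ m) * Real.log (f m + t * φ m) ∂μ)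
        (∫ m, φ m * (Real.log (f m + t * φ m) + 1) ∂μ) t) ∧
    HasDerivAt (fun t : ℝ => ∫ m, φ m * (Real.log (f m + t * φ m) + 1) ∂μ)
      (∫ m, φ m ^ 2 / f m ∂μ) 0 := by
  have key : ∀ t ∈ Metric.ball (0 : ℝ) (a / (2 * C)), ∀ m,
      a / 2 ≤ f m + t * φ m ∧ f m + t * φ m ≤ b + a := by
    intro t ht m
    rw [mem_ball_zero_iff, Real.norm_eq_abs] at ht
    have h1 : |t * φ m| ≤ a / 2 := by
      rw [abs_mul]
      calc |t| * |φ m| ≤ a / (2 * C) * C := by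
            gcongr
            exact hC m
        _ = a / 2 := by field_simp
    have h2 := abs_le.1 h1
    constructor <;> linarith [hfa m, hfb m]
  set L : ℝ := |Real.log (a / 2)| + |Real.log (b + a)| with hL
  have hlog : ∀ t ∈ Metric.ball (0 : ℝ) (a / (2 * C)), ∀ m, |Real.log (f m + t * φ m)| ≤ L := by
    intro t ht m
    obtain ⟨h1, h2⟩ := key t ht m
    have h3 := Real.log_le_log (by linarith) h1
    have h4 := Real.log_le_log (by linarith) h2
    rw [abs_le]
    constructor
    · linarith [neg_abs_le (Real.log (a / 2)), abs_nonneg (Real.log (b + a))]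
    · linarith [le_abs_self (Real.log (b + a)), abs_nonneg (Real.log (a / 2))]
  have hr : 0 < a / (4 * C) := by positivity
  have hsub : ∀ t ∈ Metric.ball (0 : ℝ) (a / (4 * C)), Metric.ball t (a / (4 * C)) ⊆
      Metric.ball (0 : ℝ) (a / (2 * C)) := by
    intro t ht s hs
    rw [Metric.mem_ball] at *
    have := dist_triangle s t 0
    have e : a / (2 * C) = a / (4 * C) + a / (4 * C) := by field_simp; norm_num
    linarith
  constructor
  · intro t ht
    have h0 : t ∈ Metric.ball (0 : ℝ) (a / (2 * C)) := hsub t ht (Metric.mem_ball_self hr)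
    refine (hasDerivAt_integral_of_dominated_loc_of_deriv_le
      (F := fun t m => (f m + t * φ m) * Real.log (f m + t * φ m))
      (F' := fun t m => φ m * (Real.log (f m + t * φ m) + 1))
      (bound := fun _ => C * (L + 1)) (Metric.ball_mem_nhds t hr) ?_ ?_ ?_ ?_ ?_ ?_).2
    · refine Eventually.of_forall fun s => Measurable.aestronglyMeasurable ?_
      fun_prop
    · refine integrable_bdd (by fun_prop) ((b + a) * L) fun m => ?_
      obtain ⟨h1, h2⟩ := key t h0 m
      rw [abs_mul]
      gcongr
      · linarith
      · rw [abs_of_nonneg (by linarith)]; exact h2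
      · exact hlog t h0 m
    · refine Measurable.aestronglyMeasurable ?_
      fun_prop
    · refine Eventually.of_forall fun m s hs => ?_
      rw [Real.norm_eq_abs, abs_mul]
      gcongr
      · exact hC m
      · refine (abs_add_le _ _).trans ?_
        rw [abs_one]
        gcongr
        exact hlog s (hsub t ht hs) m
    · exact integrable_const _
    · refine Eventually.of_forall fun m s hs => ?_
      have hpos : f m + s * φ m ≠ 0 := by
        have := (key s (hsub t ht hs) m).1
        linarith
      have d1 : HasDerivAt (fun s : ℝ => f m + s * φ m) (φ m) s := by
        simpa using ((hasDerivAt_id s).mul_const (φ m)).const_add (f m)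
      have d2 := d1.mul (d1.log hpos)
      refine d2.congr_deriv ?_
      rw [mul_div_cancel₀ _ hpos]
      ring
  · have hz : (0 : ℝ) ∈ Metric.ball (0 : ℝ) (a / (4 * C)) := Metric.mem_ball_self hr
    have e : ∫ m, φ m ^ 2 / f m ∂μ = ∫ m, φ m * (φ m / (f m + 0 * φ m)) ∂μ := by
      congr 1; ext m; rw [zero_mul, add_zero]; ring
    rw [e]
    refine (hasDerivAt_integral_of_dominated_loc_of_deriv_le
      (F := fun t m => φ m * (Real.log (f m + t * φ m) + 1))
      (F' := fun t m => φ m * (φ m / (f m + t * φ m)))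
      (bound := fun _ => C * (C / (a / 2))) (Metric.ball_mem_nhds 0 hr) ?_ ?_ ?_ ?_ ?_ ?_).2
    · refine Eventually.of_forall fun s => Measurable.aestronglyMeasurable ?_
      fun_prop
    · refine integrable_bdd (by fun_prop) (C * (L + 1)) fun m => ?_
      rw [abs_mul]
      gcongr
      · exact hC m
      · refine (abs_add_le _ _).trans ?_
        rw [abs_one]
        gcongr
        exact hlog 0 (hsub 0 hz hz) m
    · refine Measurable.aestronglyMeasurable ?_
      fun_prop
    · refine Eventually.of_forall fun m s hs => ?_
      have h1 := (key s (hsub 0 hz hs) m).1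
      rw [Real.norm_eq_abs, abs_mul, abs_div, abs_of_pos (show 0 < f m + s * φ m by linarith)]
      refine mul_le_mul (hC m) (div_le_div₀ hC0.le (hC m) (by linarith) h1) ?_ hC0.le
      exact div_nonneg (abs_nonneg _) (by linarith)
    · exact integrable_const _
    · refine Eventually.of_forall fun m s hs => ?_
      have hpos : f m + s * φ m ≠ 0 := by
        have := (key s (hsub 0 hz hs) m).1
        linarith
      have d1 : HasDerivAt (fun s : ℝ => f m + s * φ m) (φ m) s := by
        simpa using ((hasDerivAt_id s).mul_const (φ m)).const_add (f m)
      exact ((d1.log hpos).add_const 1).const_mul (φ m)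

lemma interaction_expand {X : Type*} [MeasurableSpace X] {μ : Measure X} [IsFiniteMeasure μ]
    {K : X → X → ℝ} (hK : Measurable (Function.uncurry K)) (hK1 : ∀ x y, |K x y| ≤ 1)
    {f φ : X → ℝ} (hf : Measurable f) (hφ : Measurable φ) {b D : ℝ}
    (hb : ∀ m, |f m| ≤ b) (hD : ∀ m, |φ m| ≤ D) (hmean : ∫ m, φ m ∂μ = 0) :
    ∃ J0 J1 : ℝ, ∀ t : ℝ,
      ∫ p : X × X, (1 - K p.1 p.2) * (f p.1 + t * φ p.1) * (f p.2 + t * φ p.2) ∂(μ.prod μ) =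
        J0 + t * J1 + t ^ 2 * -∫ m, (∫ m', K m m' * φ m' ∂μ) * φ m ∂μ := by
  have hK' : Measurable fun p : X × X => K p.1 p.2 := hK
  have hker : ∀ p : X × X, |1 - K p.1 p.2| ≤ 2 := fun p =>
    (abs_sub _ _).trans (by rw [abs_one]; linarith [hK1 p.1 p.2])
  have hint : ∀ (u v : X → ℝ) (A B : ℝ), Measurable u → Measurable v →
      (∀ m, |u m| ≤ A) → (∀ m, |v m| ≤ B) →
      Integrable (fun p : X × X => (1 - K p.1 p.2) * u p.1 * v p.2) (μ.prod μ) := by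
    intro u v A B hu hv hA hB
    refine integrable_bdd (by fun_prop) (2 * A * B) fun p => ?_
    have hA0 := (abs_nonneg _).trans (hA p.1)
    rw [abs_mul, abs_mul]
    gcongr
    · exact hker p
    · exact hA p.1
    · exact hB p.2
  have i0 := hint f f b b hf hf hb hb
  have i1 := hint f φ b D hf hφ hb hD
  have i2 := hint φ f D b hφ hf hD hb
  have i3 := hint φ φ D D hφ hφ hD hD
  have i12 : Integrable (fun p : X × X => ((1 - K p.1 p.2) * f p.1 * φ p.2 + (1 - K p.1 p.2) * φ p.1 * f p.2)) (μ.prod μ) := i1.add i2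
  have e3 : ∫ p : X × X, (1 - K p.1 p.2) * φ p.1 * φ p.2 ∂(μ.prod μ) =
      -∫ m, (∫ m', K m m' * φ m' ∂μ) * φ m ∂μ := by
    rw [integral_prod _ i3, ← integral_neg]
    congr 1
    ext m
    have hm : Measurable fun m' => K m m' := hK'.comp measurable_prodMk_left
    have iφ : Integrable φ μ := integrable_bdd hφ D hD
    have iK : Integrable (fun m' => K m m' * φ m') μ :=
      integrable_bdd (by fun_prop) (1 * D) fun m' => by
        rw [abs_mul]
        exact mul_le_mul (hK1 m m') (hD m') (abs_nonneg _) zero_le_one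
    have : ∀ m', (1 - K m m') * φ m * φ m' = φ m * φ m' - φ m * (K m m' * φ m') :=
      fun m' => by ring
    simp_rw [this]
    rw [integral_sub (iφ.const_mul _) (iK.const_mul _), integral_const_mul, integral_const_mul,
      hmean]
    ring
  refine ⟨∫ p : X × X, (1 - K p.1 p.2) * f p.1 * f p.2 ∂(μ.prod μ),
    ∫ p : X × X, ((1 - K p.1 p.2) * f p.1 * φ p.2 + (1 - K p.1 p.2) * φ p.1 * f p.2) ∂(μ.prod μ), fun t => ?_⟩
  have : ∀ p : X × X, (1 - K p.1 p.2) * (f p.1 + t * φ p.1) * (f p.2 + t * φ p.2) =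
      ((1 - K p.1 p.2) * f p.1 * f p.2 + t * ((1 - K p.1 p.2) * f p.1 * φ p.2 + (1 - K p.1 p.2) * φ p.1 * f p.2)) +
        t ^ 2 * ((1 - K p.1 p.2) * φ p.1 * φ p.2) :=
    fun p => by ring
  simp_rw [this]
  have iA : Integrable (fun p : X × X => (1 - K p.1 p.2) * f p.1 * f p.2 + t * ((1 - K p.1 p.2) * f p.1 * φ p.2 + (1 - K p.1 p.2) * φ p.1 * f p.2))
      (μ.prod μ) := i0.add (i12.const_mul t)
  rw [integral_add iA (i3.const_mul _), integral_add i0 (i12.const_mul t), integral_const_mul,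
    integral_const_mul, e3]

lemma pairing_eq {X : Type*} [MeasurableSpace X] {μ : Measure X} [IsFiniteMeasure μ]
    {K : X → X → ℝ} (hK : Measurable (Function.uncurry K)) (hK1 : ∀ x y, |K x y| ≤ 1)
    {f φ : X → ℝ} (hf : Measurable f) (hφ : Measurable φ) {a D : ℝ} (ha : 0 < a)
    (hfa : ∀ m, a ≤ f m) (hD : ∀ m, |φ m| ≤ D) (hmean : ∫ m, φ m ∂μ = 0) (α c : ℝ) :
    ∫ m, (φ m / f m - α * ∫ m', K m m' * φ m' ∂μ - c) * φ m ∂μ =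
      ∫ m, φ m ^ 2 / f m ∂μ + α * -∫ m, (∫ m', K m m' * φ m' ∂μ) * φ m ∂μ := by
  have hKm : Measurable fun m => ∫ m', K m m' * φ m' ∂μ := by
    refine (StronglyMeasurable.integral_prod_right (f := fun m m' => K m m' * φ m') ?_).measurable
    have hK' : Measurable fun p : X × X => K p.1 p.2 := hK
    exact Measurable.stronglyMeasurable (by simp only [Function.uncurry_def]; fun_prop)
  have hKb : ∀ m, |∫ m', K m m' * φ m' ∂μ| ≤ D * μ.real Set.univ := fun m => by
    have := norm_integral_le_of_norm_le_const (μ := μ) (f := fun m' => K m m' * φ m') (C := D)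
      (Eventually.of_forall fun m' => by
        rw [Real.norm_eq_abs, abs_mul, ← one_mul D]
        exact mul_le_mul (hK1 m m') (hD m') (abs_nonneg _) zero_le_one)
    simpa using this
  have ia : Integrable (fun m => φ m ^ 2 / f m) μ :=
    integrable_bdd (by fun_prop) (D ^ 2 / a) fun m => by
      rw [abs_div, abs_pow, abs_of_pos (ha.trans_le (hfa m))]
      exact div_le_div₀ (by positivity) (pow_le_pow_left₀ (abs_nonneg _) (hD m) 2) ha (hfa m)
  have ib : Integrable (fun m => (∫ m', K m m' * φ m' ∂μ) * φ m) μ :=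
    integrable_bdd (by fun_prop) (D * μ.real Set.univ * D) fun m => by
      rw [abs_mul]
      exact mul_le_mul (hKb m) (hD m) (abs_nonneg _) ((abs_nonneg _).trans (hKb m))
  have ic : Integrable φ μ := integrable_bdd hφ D hD
  have : ∀ m, (φ m / f m - α * ∫ m', K m m' * φ m' ∂μ - c) * φ m =
      φ m ^ 2 / f m - α * ((∫ m', K m m' * φ m' ∂μ) * φ m) - c * φ m := fun m => by ring
  simp_rw [this]
  have iab : Integrable (fun m => φ m ^ 2 / f m - α * ((∫ m', K m m' * φ m' ∂μ) * φ m)) μ :=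
    ia.sub (ib.const_mul _)
  rw [integral_sub iab (ic.const_mul _), integral_sub ia (ib.const_mul _),
    integral_const_mul, integral_const_mul, hmean]
  ring

/-- The form `secondVariation` is the second derivative of the energy at `f` in the direction of
any bounded perturbation `φ` of mean zero (for such `φ`, the function `f + t φ` is positive for
small `t`). -/
theorem energy_second_derivative {n : ℕ} (α : ℝ) {f φ : Sph n → ℝ} (hf : Measurable f)
    (hφ : Measurable φ) {a b C : ℝ} (ha : 0 < a) (hfa : ∀ m, a ≤ f m) (hfb : ∀ m, f m ≤ b)
    (hC : ∀ m, |φ m| ≤ C) (hmean : ∫ m, φ m ∂(surf n) = 0) :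
    ∃ E' : ℝ → ℝ,
      (∀ᶠ t in 𝓝 (0 : ℝ), HasDerivAt (fun t => energy n α fun m => f m + t * φ m) (E' t) t) ∧
      HasDerivAt E' (secondVariation n α f φ) 0 := by
  have hC' : ∀ m, |φ m| ≤ |C| + 1 := fun m => (hC m).trans (by linarith [le_abs_self C])
  have hC0 : 0 < |C| + 1 := by positivity
  have hb : ∀ m, |f m| ≤ b := fun m => by
    rw [abs_of_pos (ha.trans_le (hfa m))]
    exact hfb m
  have hdot : Measurable (Function.uncurry fun m m' : Sph n => dotSq m m') :=
    continuous_dotSq.measurable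
  obtain ⟨he1, he2⟩ := entropy_derivs (μ := surf n) hf hφ ha hfa hfb hC' hC0
  obtain ⟨J0, J1, hJ⟩ := interaction_expand (μ := surf n) hdot abs_dotSq_le hf hφ hb hC' hmean
  have hsv : secondVariation n α f φ = _ :=
    pairing_eq (μ := surf n) hdot abs_dotSq_le hf hφ ha hfa hC' hmean α
      (⨍ m', preHessian n α f φ m' ∂(surf n))
  rw [hsv]
  generalize -∫ m, (∫ m', dotSq m m' * φ m' ∂(surf n)) * φ m ∂(surf n) = J at hJ
  have hen : (fun t : ℝ => energy n α fun m => f m + t * φ m) = fun t =>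
      ∫ m, (f m + t * φ m) * Real.log (f m + t * φ m) ∂(surf n) +
        α / 2 * (J0 + t * J1 + t ^ 2 * J) := by
    funext t
    unfold energy
    rw [hJ t]
  rw [hen]
  refine ⟨fun t => ∫ m, φ m * (Real.log (f m + t * φ m) + 1) ∂(surf n) +
    α / 2 * (J1 + 2 * t * J), ?_, ?_⟩
  · filter_upwards [Metric.ball_mem_nhds (0 : ℝ) (show 0 < a / (4 * (|C| + 1)) by positivity)]
      with t ht
    refine (he1 t ht).add (HasDerivAt.const_mul _ ?_)
    have d := (((hasDerivAt_id t).mul_const J1).const_add J0).add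
      (((hasDerivAt_id t).pow 2).mul_const J)
    refine d.congr_deriv ?_
    simp
  · refine he2.add ?_
    have d := ((((hasDerivAt_id (0 : ℝ)).const_mul 2).mul_const J).const_add J1).const_mul
      (α / 2)
    refine d.congr_deriv ?_
    ring

end Onsager

end

/-! The kernel `(m · m')²` has finite rank, so for a mean-zero `φ` the second variation is `∫ φ²/f -
α ∑ M_ab²` with `M_ab = ∫ m_a m_b φ`, a symmetric traceless matrix (`secondVariation_eq`).
Completing a square turns stability into a bound on the `f`-variance of the quadratic forms `∑ M_ab
m_a m_b` (`isStable_of_quad_bound`). Trial functions `φ = f ψ` with `ψ` quadratic prove instability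
(`isUnstable_of_direction`).

After a rotation, `f` is proportional to `exp (η u)`, where `u` is the sum of the squares of the
coordinates in a block `s` of size `k`. Integration by parts along rotations gives all needed
integrals in terms of the moments `E u^j`, together with the recursion `mom_recursion` between these
moments. In this language `σ_k = k(n - k) / (2 (E u - E u²))`, and the recursion for `j = 0` is the
Euler–Lagrange equation.

If `η > 0` and the block has two coordinates `a ≠ b`, the direction `m_a m_b` is unstable; replacing
the block by its complement reverses the sign of `η`. This settles `2 ≤ k ≤ n / 2`, and also `k =
1`, `η < 0`. For `k = 1`, `η > 0`, a traceless form splits into three orthogonal parts. Tilting the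
axis is neutral, deformations transverse to the axis are stable, and the direction `u - E u` is
stable exactly when `n Var u ≤ 2 (E u - E u²)`. Put `p = E u - E u²`, which is `(n - 1) / (2 σ_1)`.
Since `n Var u - 2 p = 2 η p'`, this condition is about the monotonicity of `p`, and the
differential equation for `p'` shows that `p` increases and then decreases (`exists_unimodal`). The
turning point is both the minimum of `σ_1` and the stability threshold. -/

noncomputable section

namespace Onsager

variable {n : ℕ}

/-! ### Invariance of criticality and stability under `O(n)`. -/

/-- The action of a linear isometry on the unit sphere. -/
def sphHomeo (R : EuclideanSpace ℝ (Fin n) ≃ₗᵢ[ℝ] EuclideanSpace ℝ (Fin n)) : Sph n ≃ₜ Sph n where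
  toFun m := ⟨R m, by simp⟩
  invFun m := ⟨R.symm m, by simp⟩
  left_inv m := by simp
  right_inv m := by simp
  continuous_toFun := by fun_prop
  continuous_invFun := by fun_prop

@[simp] lemma sphHomeo_coe (R : EuclideanSpace ℝ (Fin n) ≃ₗᵢ[ℝ] EuclideanSpace ℝ (Fin n))
    (m : Sph n) : (sphHomeo R m : EuclideanSpace ℝ (Fin n)) = R m := rfl

@[simp] lemma sphHomeo_symm_coe (R : EuclideanSpace ℝ (Fin n) ≃ₗᵢ[ℝ] EuclideanSpace ℝ (Fin n))
    (m : Sph n) : ((sphHomeo R).symm m : EuclideanSpace ℝ (Fin n)) = R.symm m := rfl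

-- The surface measure comes from the volume of the cones `(0, 1) • s`, and `R` maps these cones to
-- one another and preserves volume.
open Pointwise in
lemma measurePreserving_sphHomeo
    (R : EuclideanSpace ℝ (Fin n) ≃ₗᵢ[ℝ] EuclideanSpace ℝ (Fin n)) :
    MeasurePreserving (sphHomeo R) (surf n) (surf n) := by
  refine ⟨(sphHomeo R).continuous.measurable, ?_⟩
  ext s hs
  have hs' : MeasurableSet (sphHomeo R ⁻¹' s) := (sphHomeo R).continuous.measurable hs
  rw [Measure.map_apply (sphHomeo R).continuous.measurable hs, Measure.toSphere_apply' _ hs',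
    Measure.toSphere_apply' _ hs]
  congr 1
  have e : Set.Ioo (0 : ℝ) 1 • ((↑) '' (sphHomeo R ⁻¹' s) : Set (EuclideanSpace ℝ (Fin n))) =
      R.toMeasurableEquiv ⁻¹' (Set.Ioo (0 : ℝ) 1 • ((↑) '' s)) := by
    ext x
    simp only [Set.mem_smul, Set.mem_image, Set.mem_preimage]
    constructor
    · rintro ⟨r, hr, _, ⟨m, hm, rfl⟩, rfl⟩
      exact ⟨r, hr, _, ⟨sphHomeo R m, hm, rfl⟩, by simp⟩
    · rintro ⟨r, hr, _, ⟨m, hm, rfl⟩, h⟩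
      refine ⟨r, hr, _, ⟨(sphHomeo R).symm m, by simpa using hm, rfl⟩, ?_⟩
      apply R.injective
      simpa using h
  rw [e]
  exact R.measurePreserving.measure_preimage_equiv (f := R.toMeasurableEquiv) _

lemma integral_sphHomeo (R : EuclideanSpace ℝ (Fin n) ≃ₗᵢ[ℝ] EuclideanSpace ℝ (Fin n))
    (F : Sph n → ℝ) : ∫ m, F (sphHomeo R m) ∂(surf n) = ∫ m, F m ∂(surf n) :=
  (measurePreserving_sphHomeo R).integral_comp (sphHomeo R).measurableEmbedding F

lemma dotSq_sphHomeo (R : EuclideanSpace ℝ (Fin n) ≃ₗᵢ[ℝ] EuclideanSpace ℝ (Fin n))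
    (m m' : Sph n) : dotSq (sphHomeo R m) (sphHomeo R m') = dotSq m m' := by
  simp [dotSq]

lemma IsCriticalPoint.comp_sphHomeo {α : ℝ} {f : Sph n → ℝ} (hf : IsCriticalPoint n α f)
    (R : EuclideanSpace ℝ (Fin n) ≃ₗᵢ[ℝ] EuclideanSpace ℝ (Fin n)) :
    IsCriticalPoint n α (fun m => f (sphHomeo R m)) := by
  obtain ⟨h1, h2, c, h3⟩ := hf
  refine ⟨fun m => h1 _, by rw [integral_sphHomeo R f, h2], c, fun m => ?_⟩
  rw [← h3 (sphHomeo R m), ← integral_sphHomeo R (fun m' => dotSq (sphHomeo R m) m' * f m')]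
  simp_rw [dotSq_sphHomeo]

lemma preHessian_comp_sphHomeo (α : ℝ) (f φ : Sph n → ℝ)
    (R : EuclideanSpace ℝ (Fin n) ≃ₗᵢ[ℝ] EuclideanSpace ℝ (Fin n)) (m : Sph n) :
    preHessian n α (fun m => f (sphHomeo R m)) (fun m => φ (sphHomeo R m)) m =
      preHessian n α f φ (sphHomeo R m) := by
  unfold preHessian
  rw [← integral_sphHomeo R (fun m' => dotSq (sphHomeo R m) m' * φ m')]
  simp_rw [dotSq_sphHomeo]

lemma secondVariation_comp_sphHomeo (α : ℝ) (f φ : Sph n → ℝ)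
    (R : EuclideanSpace ℝ (Fin n) ≃ₗᵢ[ℝ] EuclideanSpace ℝ (Fin n)) :
    secondVariation n α (fun m => f (sphHomeo R m)) (fun m => φ (sphHomeo R m)) =
      secondVariation n α f φ := by
  unfold secondVariation hessian
  simp_rw [preHessian_comp_sphHomeo, average_eq,
    integral_sphHomeo R (fun m => preHessian n α f φ m)]
  exact integral_sphHomeo R (fun m => (preHessian n α f φ m -
    ((surf n).real Set.univ)⁻¹ • ∫ m', preHessian n α f φ m' ∂(surf n)) * φ m)

lemma Perturbation.comp_sphHomeo {φ : Sph n → ℝ} (hφ : Perturbation n φ)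
    (R : EuclideanSpace ℝ (Fin n) ≃ₗᵢ[ℝ] EuclideanSpace ℝ (Fin n)) :
    Perturbation n (fun m => φ (sphHomeo R m)) :=
  ⟨hφ.1.comp_measurePreserving (measurePreserving_sphHomeo R), by
    rw [integral_sphHomeo R φ, hφ.2]⟩

lemma IsStable.comp_sphHomeo {α : ℝ} {f : Sph n → ℝ} (hf : IsStable n α f)
    (R : EuclideanSpace ℝ (Fin n) ≃ₗᵢ[ℝ] EuclideanSpace ℝ (Fin n)) :
    IsStable n α (fun m => f (sphHomeo R m)) := by
  refine ⟨hf.1.comp_sphHomeo R, fun φ hφ => ?_⟩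
  have h1 := hf.2 _ (hφ.comp_sphHomeo R.symm)
  rw [← secondVariation_comp_sphHomeo α f _ R] at h1
  convert h1 using 3
  exact congrArg φ (Subtype.ext (by simp))

lemma IsUnstable.comp_sphHomeo {α : ℝ} {f : Sph n → ℝ} (hf : IsUnstable n α f)
    (R : EuclideanSpace ℝ (Fin n) ≃ₗᵢ[ℝ] EuclideanSpace ℝ (Fin n)) :
    IsUnstable n α (fun m => f (sphHomeo R m)) := by
  refine ⟨hf.1.comp_sphHomeo R, fun h => hf.2 ?_⟩
  convert h.comp_sphHomeo R.symm using 2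
  exact congrArg f (Subtype.ext (by simp))

/-! ### Derivatives along plane rotations. -/

lemma integrable_of_continuous {F : Sph n → ℝ} (hF : Continuous F) : Integrable F (surf n) :=
  hF.integrable_of_hasCompactSupport (HasCompactSupport.of_compactSpace F)

/-- The rotation by the angle `t` in the plane of the coordinates `i`, `j` (the identity if
`i = j`). -/
def rotLin (i j : Fin n) (t : ℝ) : EuclideanSpace ℝ (Fin n) →ₗ[ℝ] EuclideanSpace ℝ (Fin n) where
  -- With the identity for `i = j`, sums over all `l` in a block may include the rotation "in the
  -- plane `a`, `a`", whose derivative is zero.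
  toFun x := WithLp.toLp 2 fun l => if i = j then x l else
    if l = i then Real.cos t * x i - Real.sin t * x j else
    if l = j then Real.sin t * x i + Real.cos t * x j else x l
  map_add' x y := by
    ext l
    simp only [PiLp.add_apply]
    split_ifs <;> ring
  map_smul' c x := by
    ext l
    simp only [PiLp.smul_apply, smul_eq_mul, RingHom.id_apply]
    split_ifs <;> ring

lemma norm_rotLin (i j : Fin n) (t : ℝ) (x : EuclideanSpace ℝ (Fin n)) :
    ‖rotLin i j t x‖ = ‖x‖ := by
  rw [← sq_eq_sq₀ (norm_nonneg _) (norm_nonneg _), EuclideanSpace.real_norm_sq_eq,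
    EuclideanSpace.real_norm_sq_eq, ← sub_eq_zero, ← Finset.sum_sub_distrib]
  by_cases hij : i = j
  · simp [rotLin, hij]
  rw [Fintype.sum_eq_add i j hij]
  · simp only [rotLin, LinearMap.coe_mk, AddHom.coe_mk, hij, if_false, if_true, Ne.symm hij]
    linear_combination (x i ^ 2 + x j ^ 2) * Real.sin_sq_add_cos_sq t
  · rintro l ⟨h1, h2⟩
    simp [rotLin, h1, h2]

/-- `rotLin` as a linear isometry onto. -/
def rot (i j : Fin n) (t : ℝ) : EuclideanSpace ℝ (Fin n) ≃ₗᵢ[ℝ] EuclideanSpace ℝ (Fin n) :=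
  LinearIsometry.toLinearIsometryEquiv ⟨rotLin i j t, norm_rotLin i j t⟩ rfl

lemma rot_apply (i j : Fin n) (t : ℝ) (x : EuclideanSpace ℝ (Fin n)) (l : Fin n) :
    rot i j t x l = if i = j then x l else
      if l = i then Real.cos t * x i - Real.sin t * x j else
      if l = j then Real.sin t * x i + Real.cos t * x j else x l := rfl

lemma rot_add (i j : Fin n) (s t : ℝ) (x : EuclideanSpace ℝ (Fin n)) :
    rot i j (s + t) x = rot i j s (rot i j t x) := by
  ext l
  by_cases hij : i = j
  · simp [rot_apply, hij]
  simp only [rot_apply, hij, Ne.symm hij, if_false, if_true, Real.cos_add, Real.sin_add]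
  split_ifs <;> ring

/-- The function `F'` is the derivative of `F` along the rotation field
`m_i ∂_j - m_j ∂_i`. -/
def RotDeriv (i j : Fin n) (F F' : Sph n → ℝ) : Prop :=
  ∀ m, HasDerivAt (fun t => F (sphHomeo (rot i j t) m)) (F' m) 0

lemma sphHomeo_rot_zero (i j : Fin n) (m : Sph n) : sphHomeo (rot i j 0) m = m := by
  apply Subtype.ext
  ext l
  simp only [sphHomeo_coe, rot_apply]
  split_ifs <;> simp_all

/-- The integral of `F` over the rotated sphere does not depend on the angle; differentiate under
the integral. All integrations by parts on the sphere rest on this. -/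
lemma RotDeriv.integral_eq_zero {i j : Fin n} {F F' : Sph n → ℝ} (h : RotDeriv i j F F')
    (hF : Continuous F) (hF' : Continuous F') : ∫ m, F' m ∂(surf n) = 0 := by
  -- Differentiation under the integral needs the derivative at all angles; the group law of the
  -- rotations carries it over from angle `0`.
  have hd : ∀ m t, HasDerivAt (fun t => F (sphHomeo (rot i j t) m))
      (F' (sphHomeo (rot i j t) m)) t := by
    intro m t
    have h1 := h (sphHomeo (rot i j t) m)
    have h2 : HasDerivAt (fun s : ℝ => s - t) 1 t := (hasDerivAt_id t).sub_const t
    have h3 := HasDerivAt.comp (h₂ := fun s => F (sphHomeo (rot i j s) (sphHomeo (rot i j t) m))) t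
      (by simpa using h1) h2
    rw [mul_one] at h3
    refine h3.congr_of_eventuallyEq (Eventually.of_forall fun s => ?_)
    refine congrArg F (Subtype.ext ?_)
    change rot i j s m = rot i j (s - t) (rot i j t m)
    rw [← rot_add, sub_add_cancel]
  obtain ⟨C, hC⟩ := (isCompact_range hF').isBounded.exists_norm_le
  have key := (hasDerivAt_integral_of_dominated_loc_of_deriv_le (μ := surf n) (x₀ := (0 : ℝ))
    (F := fun t m => F (sphHomeo (rot i j t) m)) (F' := fun t m => F' (sphHomeo (rot i j t) m))
    (bound := fun _ => C) (s := Set.univ) univ_mem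
    (Eventually.of_forall fun t =>
      (hF.comp (sphHomeo (rot i j t)).continuous).aestronglyMeasurable)
    (integrable_of_continuous (hF.comp (sphHomeo (rot i j 0)).continuous))
    (hF'.comp (sphHomeo (rot i j 0)).continuous).aestronglyMeasurable
    (Eventually.of_forall fun m t _ => hC _ ⟨_, rfl⟩) (integrable_const _)
    (Eventually.of_forall fun m t _ => hd m t)).2
  simp_rw [integral_sphHomeo _ F, integral_sphHomeo _ F'] at key
  exact key.unique (hasDerivAt_const _ _)

lemma RotDeriv.mul {i j : Fin n} {F F' G G' : Sph n → ℝ} (hF : RotDeriv i j F F')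
    (hG : RotDeriv i j G G') :
    RotDeriv i j (fun m => F m * G m) (fun m => F' m * G m + F m * G' m) := fun m => by
  simpa [sphHomeo_rot_zero] using (hF m).fun_mul (hG m)

lemma RotDeriv.sum {ι : Type*} {i j : Fin n} {s : Finset ι} {F F' : ι → Sph n → ℝ}
    (h : ∀ a ∈ s, RotDeriv i j (F a) (F' a)) :
    RotDeriv i j (fun m => ∑ a ∈ s, F a m) (fun m => ∑ a ∈ s, F' a m) := fun m =>
  HasDerivAt.fun_sum fun a ha => h a ha m

lemma RotDeriv.comp {i j : Fin n} {F F' : Sph n → ℝ} (h : RotDeriv i j F F') {g g' : ℝ → ℝ}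
    (hg : ∀ x, HasDerivAt g (g' x) x) :
    RotDeriv i j (fun m => g (F m)) (fun m => g' (F m) * F' m) := fun m => by
  have h1 := h m
  have h2 : HasDerivAt g (g' (F m)) (F (sphHomeo (rot i j 0) m)) := by
    rw [sphHomeo_rot_zero]; exact hg _
  exact h2.comp (0 : ℝ) h1

/-! ### Coordinates and sums of squares over a block. -/

/-- The coordinates of a point of the sphere. -/
abbrev crd (l : Fin n) (m : Sph n) : ℝ := (m : EuclideanSpace ℝ (Fin n)) l

@[fun_prop] lemma continuous_crd (l : Fin n) : Continuous (crd l : Sph n → ℝ) := by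
  unfold crd; fun_prop

/-- The Kronecker delta. -/
abbrev kd (a b : Fin n) : ℝ := if a = b then 1 else 0

lemma rotDeriv_crd (i j l : Fin n) :
    RotDeriv i j (crd l) (fun m => kd l j * crd i m - kd l i * crd j m) := fun m => by
  simp only [crd, sphHomeo_coe, rot_apply, kd]
  by_cases hij : i = j
  · simp only [hij, if_true, sub_self]
    exact hasDerivAt_const _ _
  simp only [hij, if_false]
  have hc := Real.hasDerivAt_cos 0
  have hs := Real.hasDerivAt_sin 0
  rw [Real.sin_zero, neg_zero] at hc
  rw [Real.cos_zero] at hs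
  by_cases h1 : l = i
  · subst h1
    simp only [if_true, hij, if_false]
    simpa using (hc.mul_const (crd l m)).fun_sub (hs.mul_const (crd j m))
  by_cases h2 : l = j
  · subst h2
    simp only [if_true, h1, if_false]
    simpa using (hs.mul_const (crd i m)).fun_add (hc.mul_const (crd l m))
  simp only [h1, h2, if_false]
  simpa using hasDerivAt_const (0 : ℝ) (crd l m)

/-- The sum of the squares of the coordinates in `s`. -/
def sq (s : Finset (Fin n)) (m : Sph n) : ℝ := ∑ l ∈ s, crd l m ^ 2

@[fun_prop] lemma continuous_sq (s : Finset (Fin n)) : Continuous (sq s) := by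
  unfold sq
  fun_prop

lemma sq_univ (m : Sph n) : sq Finset.univ m = 1 := by
  have h := EuclideanSpace.real_norm_sq_eq (m : EuclideanSpace ℝ (Fin n))
  rw [norm_eq_of_mem_sphere] at h
  unfold sq
  rw [← h, one_pow]

lemma sq_compl (s : Finset (Fin n)) (m : Sph n) : sq sᶜ m = 1 - sq s m := by
  rw [← sq_univ m, eq_sub_iff_add_eq]
  exact Finset.sum_compl_add_sum s _

lemma sq_nonneg' (s : Finset (Fin n)) (m : Sph n) : 0 ≤ sq s m :=
  Finset.sum_nonneg fun _ _ => sq_nonneg _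

lemma sq_le_one (s : Finset (Fin n)) (m : Sph n) : sq s m ≤ 1 := by
  have h := sq_nonneg' sᶜ m
  rw [sq_compl] at h
  linarith

lemma rotDeriv_sq (s : Finset (Fin n)) (i j : Fin n) :
    RotDeriv i j (sq s) (fun m =>
      2 * ((if j ∈ s then 1 else 0) - (if i ∈ s then 1 else 0)) * (crd i m * crd j m)) := by
  have h := RotDeriv.sum (s := s) fun l _ => (rotDeriv_crd i j l).mul (rotDeriv_crd i j l)
  intro m
  convert h m using 1
  · funext t
    exact Finset.sum_congr rfl fun l _ => pow_two _
  · have e : ∀ l ∈ s, (kd l j * crd i m - kd l i * crd j m) * crd l m +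
        crd l m * (kd l j * crd i m - kd l i * crd j m) =
        (if j = l then 2 * crd i m * crd l m else 0) -
          (if i = l then 2 * crd j m * crd l m else 0) := by
      intro l _
      simp only [kd, eq_comm (a := l)]
      split_ifs <;> ring
    beta_reduce
    rw [Finset.sum_congr rfl e, Finset.sum_sub_distrib, Finset.sum_ite_eq, Finset.sum_ite_eq]
    split_ifs <;> ring

/-! ### Coordinate moments for rotation-invariant weights. -/

/-- Continuous functions that are invariant under the rotations of the coordinates in `s`. -/
def RotInv (s : Finset (Fin n)) (G : Sph n → ℝ) : Prop :=
  Continuous G ∧ ∀ i ∈ s, ∀ j ∈ s, RotDeriv i j G (fun _ => 0)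

lemma RotInv.mul {s : Finset (Fin n)} {F G : Sph n → ℝ} (hF : RotInv s F) (hG : RotInv s G) :
    RotInv s (fun m => F m * G m) :=
  ⟨hF.1.mul hG.1, fun i hi j hj => by simpa using (hF.2 i hi j hj).mul (hG.2 i hi j hj)⟩

lemma rotInv_const (s : Finset (Fin n)) (c : ℝ) : RotInv s (fun _ => c) :=
  ⟨continuous_const, fun _ _ _ _ _ => hasDerivAt_const _ _⟩

lemma rotInv_crd {s : Finset (Fin n)} {q : Fin n} (hq : q ∉ s) : RotInv s (crd q) := by
  refine ⟨continuous_crd q, fun i hi j hj => ?_⟩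
  have h := rotDeriv_crd i j q
  have h1 : q ≠ i := fun h => hq (h ▸ hi)
  have h2 : q ≠ j := fun h => hq (h ▸ hj)
  simpa [kd, h1, h2] using h

lemma rotInv_sq (s : Finset (Fin n)) : RotInv s (sq s) := by
  refine ⟨continuous_sq s, fun i hi j hj => ?_⟩
  simpa [hi, hj] using rotDeriv_sq s i j

lemma RotInv.comp {s : Finset (Fin n)} {F : Sph n → ℝ} (hF : RotInv s F) {g g' : ℝ → ℝ}
    (hg : ∀ x, HasDerivAt g (g' x) x) : RotInv s (fun m => g (F m)) :=
  ⟨(continuous_iff_continuousAt.2 fun x => (hg x).continuousAt).comp hF.1,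
    fun i hi j hj => by simpa using (hF.2 i hi j hj).comp hg⟩

lemma rotInv_exp_sq (s : Finset (Fin n)) (η : ℝ) : RotInv s (fun m => Real.exp (η * sq s m)) :=
  (rotInv_sq s).comp (g' := fun x => Real.exp (η * x) * η)
    fun x => by simpa using ((hasDerivAt_id x).const_mul η).exp

/-- `F` behaves under rotations in `s` like a polynomial that is homogeneous of degree `D` in
these coordinates, with derivative `A` in the direction `a`. -/
def Euler (s : Finset (Fin n)) (a : Fin n) (F A : Sph n → ℝ) (D : ℝ) : Prop :=
  Continuous F ∧ Continuous A ∧ ∃ F' : Fin n → Sph n → ℝ,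
    (∀ l ∈ s, Continuous (F' l) ∧ RotDeriv l a F (F' l)) ∧
    ∀ m, ∑ l ∈ s, crd l m * F' l m = sq s m * A m - D * (crd a m * F m)

lemma Euler.mul {s : Finset (Fin n)} {a : Fin n} {F A G B : Sph n → ℝ} {D D' : ℝ}
    (hF : Euler s a F A D) (hG : Euler s a G B D') :
    Euler s a (fun m => F m * G m) (fun m => A m * G m + F m * B m) (D + D') := by
  obtain ⟨f1, f2, F', f3, f4⟩ := hF
  obtain ⟨g1, g2, G', g3, g4⟩ := hG
  refine ⟨by fun_prop, by fun_prop, fun l m => F' l m * G m + F m * G' l m, fun l hl =>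
    ⟨((f3 l hl).1.mul g1).add (f1.mul (g3 l hl).1), (f3 l hl).2.mul (g3 l hl).2⟩, fun m => ?_⟩
  have e : ∀ l ∈ s, crd l m * (F' l m * G m + F m * G' l m) =
      G m * (crd l m * F' l m) + F m * (crd l m * G' l m) := fun l _ => by ring
  rw [Finset.sum_congr rfl e, Finset.sum_add_distrib, ← Finset.mul_sum, ← Finset.mul_sum, f4, g4]
  ring

lemma euler_one (s : Finset (Fin n)) (a : Fin n) : Euler s a (fun _ => 1) (fun _ => 0) 0 :=
  ⟨continuous_const, continuous_const, fun _ _ => 0,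
    fun l _ => ⟨continuous_const, fun _ => hasDerivAt_const _ _⟩, fun m => by simp⟩

lemma euler_crd {s : Finset (Fin n)} (a : Fin n) {b : Fin n} (hb : b ∈ s) :
    Euler s a (crd b) (fun _ => kd b a) 1 := by
  refine ⟨continuous_crd b, continuous_const, fun l m => kd b a * crd l m - kd b l * crd a m,
    fun l _ => ⟨by fun_prop, rotDeriv_crd l a b⟩, fun m => ?_⟩
  have e : ∀ l ∈ s, crd l m * (kd b a * crd l m - kd b l * crd a m) =
      kd b a * crd l m ^ 2 - (if b = l then crd l m * crd a m else 0) := fun l _ => by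
    simp only [kd]
    split_ifs <;> ring
  rw [Finset.sum_congr rfl e, Finset.sum_sub_distrib, Finset.sum_ite_eq, if_pos hb,
    ← Finset.mul_sum]
  simp only [sq]
  ring

/-- Integration by parts over the rotations of the coordinates in `s`. -/
lemma RotInv.integral_euler {s : Finset (Fin n)} {a : Fin n} {G F A : Sph n → ℝ} {D : ℝ}
    (hG : RotInv s G) (ha : a ∈ s) (hF : Euler s a F A D) :
    ((s.card : ℝ) - 1 + D) * ∫ m, G m * (crd a m * F m) ∂(surf n) =
      ∫ m, G m * sq s m * A m ∂(surf n) := by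
  obtain ⟨f1, f2, F', f3, f4⟩ := hF
  have g1 := hG.1
  have hc : ∀ l ∈ s, Continuous fun m =>
      G m * ((kd l a * crd l m - kd l l * crd a m) * F m + crd l m * F' l m) := fun l hl => by
    have := (f3 l hl).1
    fun_prop
  -- The integrand is the derivative of `G m_l F` along the rotation of `l` and `a`. In the sum over
  -- `l`, the derivatives of `m_l` add up to `-(card - 1) m_a`, and the Euler relation supplies the
  -- rest.
  have h0 : ∀ l ∈ s, ∫ m,
      G m * ((kd l a * crd l m - kd l l * crd a m) * F m + crd l m * F' l m) ∂(surf n) = 0 := by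
    intro l hl
    have h := (hG.2 l hl a ha).mul ((rotDeriv_crd l a l).mul (f3 l hl).2)
    simp only [zero_mul, zero_add] at h
    exact h.integral_eq_zero (by fun_prop) (hc l hl)
  have h1 := Finset.sum_eq_zero h0
  rw [← integral_finsetSum _ fun l hl => integrable_of_continuous (hc l hl)] at h1
  have e : ∀ m, ∑ l ∈ s, G m * ((kd l a * crd l m - kd l l * crd a m) * F m + crd l m * F' l m) =
      G m * sq s m * A m - ((s.card : ℝ) - 1 + D) * (G m * (crd a m * F m)) := by
    intro m
    have e1 : ∀ l ∈ s,
        G m * ((kd l a * crd l m - kd l l * crd a m) * F m + crd l m * F' l m) =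
        (if a = l then G m * F m * crd l m else 0) - G m * (crd a m * F m) +
          G m * (crd l m * F' l m) := fun l _ => by
      simp only [kd, if_true, eq_comm (a := l)]
      split_ifs <;> ring
    rw [Finset.sum_congr rfl e1, Finset.sum_add_distrib, Finset.sum_sub_distrib,
      Finset.sum_ite_eq, if_pos ha, Finset.sum_const, nsmul_eq_mul, ← Finset.mul_sum, f4]
    ring
  simp_rw [e] at h1
  rw [integral_sub (integrable_of_continuous (by fun_prop))
    (integrable_of_continuous (by fun_prop)), integral_const_mul, sub_eq_zero] at h1
  exact h1.symm

/-- With `F = 1` the factor in `integral_euler` is `card - 1`; a block of one coordinate has no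
rotations and gives no information. -/
lemma RotInv.integral_crd {s : Finset (Fin n)} {a : Fin n} {G : Sph n → ℝ} (hG : RotInv s G)
    (ha : a ∈ s) (hs : 2 ≤ s.card) : ∫ m, G m * crd a m ∂(surf n) = 0 := by
  have h := hG.integral_euler ha (euler_one s a)
  have hs' : (2 : ℝ) ≤ s.card := by exact_mod_cast hs
  simp only [mul_one, mul_zero, integral_zero, mul_eq_zero] at h
  exact h.resolve_left (by linarith)

lemma RotInv.integral_crd_two {s : Finset (Fin n)} {a b : Fin n} {G : Sph n → ℝ}
    (hG : RotInv s G) (ha : a ∈ s) (hb : b ∈ s) :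
    s.card * ∫ m, G m * (crd a m * crd b m) ∂(surf n) =
      kd b a * ∫ m, G m * sq s m ∂(surf n) := by
  have h := hG.integral_euler ha (euler_crd a hb)
  rw [sub_add_cancel, integral_mul_const] at h
  rw [h, mul_comm]

lemma RotInv.integral_crd_three {s : Finset (Fin n)} {a b c : Fin n} {G : Sph n → ℝ}
    (hG : RotInv s G) (ha : a ∈ s) (hb : b ∈ s) (hc : c ∈ s) (hs : 2 ≤ s.card) :
    ∫ m, G m * (crd a m * (crd b m * crd c m)) ∂(surf n) = 0 := by
  have h := hG.integral_euler ha ((euler_crd a hb).mul (euler_crd a hc))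
  have g1 := hG.1
  have hs' : (2 : ℝ) ≤ s.card := by exact_mod_cast hs
  have hG2 := hG.mul (rotInv_sq s)
  have e : ∀ m, G m * sq s m * (kd b a * crd c m + crd b m * kd c a) =
      kd b a * (G m * sq s m * crd c m) + kd c a * (G m * sq s m * crd b m) := fun m => by ring
  simp_rw [e] at h
  rw [integral_add (integrable_of_continuous (by fun_prop))
    (integrable_of_continuous (by fun_prop)), integral_const_mul, integral_const_mul,
    hG2.integral_crd hc hs, hG2.integral_crd hb hs, mul_zero, mul_zero, add_zero,
    mul_eq_zero] at h
  exact h.resolve_left (by linarith)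

/-- Applying `integral_euler` to `F = m_b m_c m_d` removes the factor `m_a` by pairing it with each
of the others, and the second moments for the weight `G * sq s` finish. The three products are the
pairings of four indices. -/
lemma RotInv.integral_crd_four {s : Finset (Fin n)} {a b c d : Fin n} {G : Sph n → ℝ}
    (hG : RotInv s G) (ha : a ∈ s) (hb : b ∈ s) (hc : c ∈ s) (hd : d ∈ s) :
    (s.card : ℝ) * (s.card + 2) *
        ∫ m, G m * (crd a m * (crd b m * (crd c m * crd d m))) ∂(surf n) =
      (kd b a * kd d c + kd c a * kd d b + kd d a * kd c b) *
        ∫ m, G m * sq s m ^ 2 ∂(surf n) := by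
  have h := hG.integral_euler ha ((euler_crd a hb).mul ((euler_crd a hc).mul (euler_crd a hd)))
  have g1 := hG.1
  have hG2 := hG.mul (rotInv_sq s)
  have e : ∀ m, G m * sq s m * (kd b a * (crd c m * crd d m) +
      crd b m * (kd c a * crd d m + crd c m * kd d a)) =
      kd b a * (G m * sq s m * (crd c m * crd d m)) +
      (kd c a * (G m * sq s m * (crd b m * crd d m)) +
        kd d a * (G m * sq s m * (crd b m * crd c m))) := fun m => by ring
  simp_rw [e] at h
  rw [integral_add (integrable_of_continuous (by fun_prop))
    (integrable_of_continuous (by fun_prop)), integral_add (integrable_of_continuous (by fun_prop))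
    (integrable_of_continuous (by fun_prop)), integral_const_mul, integral_const_mul,
    integral_const_mul] at h
  have h1 := hG2.integral_crd_two hc hd
  have h2 := hG2.integral_crd_two hb hd
  have h3 := hG2.integral_crd_two hb hc
  have e2 : ∀ m, G m * sq s m * sq s m = G m * sq s m ^ 2 := fun m => by ring
  simp_rw [e2] at h1 h2 h3
  linear_combination (s.card : ℝ) * h + kd b a * h1 + kd c a * h2 + kd d a * h3

/-- Integration by parts over the rotations that mix the coordinates in `s` with the others. -/
lemma integral_mixed (s : Finset (Fin n)) {g g' : ℝ → ℝ} (hg : ∀ x, HasDerivAt g (g' x) x)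
    (hg' : Continuous g') :
    ∫ m, ((n * sq s m - s.card) * g (sq s m) -
      2 * (sq s m * (1 - sq s m)) * g' (sq s m)) ∂(surf n) = 0 := by
  have cg : Continuous g := continuous_iff_continuousAt.2 fun x => (hg x).continuousAt
  -- This is the derivative of `m_i m_j g(sq s)` along the rotation of `i` and `j`. The sum over `i
  -- ∈ s`, `j ∉ s` depends only on `sq s`.
  have h0 : ∀ i ∈ s, ∀ j ∈ sᶜ, ∫ m, ((crd i m ^ 2 - crd j m ^ 2) * g (sq s m) -
      2 * (crd i m ^ 2 * crd j m ^ 2) * g' (sq s m)) ∂(surf n) = 0 := by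
    intro i hi j hj
    have hj' : j ∉ s := Finset.mem_compl.1 hj
    have hij : i ≠ j := fun h => hj' (h ▸ hi)
    have h := ((rotDeriv_crd i j i).mul (rotDeriv_crd i j j)).mul ((rotDeriv_sq s i j).comp hg)
    have h1 := h.integral_eq_zero (by fun_prop) (by fun_prop)
    rw [← h1]
    congr 1
    funext m
    simp only [kd, hij, hij.symm, hi, hj', if_true, if_false]
    ring
  have hc : ∀ i j : Fin n, Continuous fun m => (crd i m ^ 2 - crd j m ^ 2) * g (sq s m) -
      2 * (crd i m ^ 2 * crd j m ^ 2) * g' (sq s m) := fun i j => by fun_prop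
  have h1 := Finset.sum_eq_zero fun i hi => Finset.sum_eq_zero (h0 i hi)
  simp_rw [← integral_finsetSum sᶜ fun j _ => integrable_of_continuous (hc _ j)] at h1
  rw [← integral_finsetSum s fun i _ => integrable_of_continuous
    (continuous_finsetSum _ fun j _ => hc i j)] at h1
  rw [← h1]
  congr 1
  funext m
  have hcard : (sᶜ.card : ℝ) = n - s.card := by
    rw [Finset.card_compl, Fintype.card_fin, Nat.cast_sub]
    simpa using s.card_le_univ
  have hcm : ∑ j ∈ sᶜ, crd j m ^ 2 = 1 - sq s m := sq_compl s m
  have hsm : ∑ i ∈ s, crd i m ^ 2 = sq s m := rfl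
  simp_rw [Finset.sum_sub_distrib, ← Finset.sum_mul, Finset.sum_sub_distrib, Finset.sum_const,
    ← Finset.mul_sum, nsmul_eq_mul, hcard, hcm, ← Finset.sum_mul, ← Finset.mul_sum, hsm]
  ring

/-! ### The densities `exp (η u)` and the moments of `u`. -/

instance instNeZeroSurf [NeZero n] : NeZero (surf n) := ⟨Measure.toSphere_ne_zero _⟩

/-- The probability density proportional to `exp (η ∑_{l ∈ s} m_l²)`. -/
def dens (s : Finset (Fin n)) (η : ℝ) (m : Sph n) : ℝ :=
  Real.exp (η * sq s m) / ∫ m', Real.exp (η * sq s m') ∂(surf n)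

/-- The moments of `∑_{l ∈ s} m_l²` for the density `dens s η`. -/
def mom (s : Finset (Fin n)) (η : ℝ) (j : ℕ) : ℝ := ∫ m, dens s η m * sq s m ^ j ∂(surf n)

@[fun_prop] lemma continuous_dens (s : Finset (Fin n)) (η : ℝ) : Continuous (dens s η) := by
  unfold dens
  fun_prop

lemma integral_exp_sq_pos [NeZero n] (s : Finset (Fin n)) (η : ℝ) :
    0 < ∫ m', Real.exp (η * sq s m') ∂(surf n) :=
  integral_exp_pos (integrable_of_continuous (by fun_prop))

lemma dens_pos [NeZero n] (s : Finset (Fin n)) (η : ℝ) (m : Sph n) : 0 < dens s η m :=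
  div_pos (Real.exp_pos _) (integral_exp_sq_pos s η)

lemma integral_dens [NeZero n] (s : Finset (Fin n)) (η : ℝ) : ∫ m, dens s η m ∂(surf n) = 1 := by
  unfold dens
  rw [integral_div, div_self (integral_exp_sq_pos s η).ne']

lemma mom_zero [NeZero n] (s : Finset (Fin n)) (η : ℝ) : mom s η 0 = 1 := by
  simp [mom, integral_dens]

/-- The two sums of squares add up to `1`, so the exponents differ by a constant, which the
normalization cancels. This reduces negative `η` to positive `η`. -/
lemma dens_compl (s : Finset (Fin n)) (η : ℝ) : dens sᶜ (-η) = dens s η := by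
  funext m
  have e : ∀ m, Real.exp (-η * sq sᶜ m) = Real.exp (-η) * Real.exp (η * sq s m) := fun m => by
    rw [sq_compl, ← Real.exp_add]
    ring_nf
  unfold dens
  simp_rw [e, integral_const_mul]
  rw [mul_div_mul_left _ _ (Real.exp_ne_zero _)]

lemma rotInv_dens (s : Finset (Fin n)) (η : ℝ) : RotInv s (dens s η) := by
  unfold dens
  simp_rw [div_eq_mul_inv]
  exact (rotInv_exp_sq s η).mul (rotInv_const s _)

lemma rotInv_compl_dens (s : Finset (Fin n)) (η : ℝ) : RotInv sᶜ (dens s η) := by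
  rw [← dens_compl]
  exact rotInv_dens _ _

lemma rotInv_compl_sq (s : Finset (Fin n)) : RotInv sᶜ (sq s) := by
  have e : sq s = fun m => 1 - sq sᶜ m := by
    funext m
    rw [sq_compl]
    ring
  rw [e]
  exact (rotInv_sq sᶜ).comp (g := fun x => 1 - x) (g' := fun _ => -1)
    fun x => by simpa using (hasDerivAt_id x).const_sub 1

lemma card_compl_cast (s : Finset (Fin n)) : (sᶜ.card : ℝ) = n - s.card := by
  rw [Finset.card_compl, Fintype.card_fin, Nat.cast_sub]
  simpa using s.card_le_univ

lemma integral_dens_mul_linear (s : Finset (Fin n)) (η c₁ c₂ : ℝ) (i j : ℕ) :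
    ∫ m, dens s η m * (c₁ * sq s m ^ i + c₂ * sq s m ^ j) ∂(surf n) =
      c₁ * mom s η i + c₂ * mom s η j := by
  have e : ∀ m, dens s η m * (c₁ * sq s m ^ i + c₂ * sq s m ^ j) =
      c₁ * (dens s η m * sq s m ^ i) + c₂ * (dens s η m * sq s m ^ j) := fun m => by ring
  simp_rw [e]
  rw [integral_add (integrable_of_continuous (by fun_prop))
    (integrable_of_continuous (by fun_prop)), integral_const_mul, integral_const_mul]
  rfl

/-- This is `integral_mixed` for `g(x) = x^j exp (η x)`, divided by the normalizing constant. -/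
lemma mom_recursion (s : Finset (Fin n)) (η : ℝ) (j : ℕ) :
    (n + 2 * j) * mom s η (j + 1) - (s.card + 2 * j) * mom s η j =
      2 * η * (mom s η (j + 1) - mom s η (j + 2)) := by
  have h := integral_mixed s (g := fun x => x ^ j * Real.exp (η * x))
    (g' := fun x => (j * x ^ (j - 1)) * Real.exp (η * x) + x ^ j * (Real.exp (η * x) * η))
    (fun x => (hasDerivAt_pow j x).fun_mul
      (by simpa using ((hasDerivAt_id x).const_mul η).exp)) (by fun_prop)
  have h2 := congrArg (fun x => x / ∫ m', Real.exp (η * sq s m') ∂(surf n)) h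
  simp only [zero_div, ← integral_div] at h2
  have e : ∀ m, ((n * sq s m - s.card) * (sq s m ^ j * Real.exp (η * sq s m)) -
      2 * (sq s m * (1 - sq s m)) * ((j * sq s m ^ (j - 1)) * Real.exp (η * sq s m) +
        sq s m ^ j * (Real.exp (η * sq s m) * η))) / ∫ m', Real.exp (η * sq s m') ∂(surf n) =
      dens s η m * ((n + 2 * j - 2 * η) * sq s m ^ (j + 1) + (-(s.card + 2 * j)) * sq s m ^ j) +
        dens s η m * (2 * η * sq s m ^ (j + 2) + 0 * sq s m ^ 0) := fun m => by
    -- For `j = 0` the truncated exponent `j - 1` is harmless because of the factor `j`.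
    have e1 : (j : ℝ) * sq s m ^ (j - 1) * sq s m = j * sq s m ^ j := by
      rcases j with _ | j
      · simp
      · rw [Nat.add_sub_cancel]; ring
    unfold dens
    linear_combination (-2 * (1 - sq s m) * Real.exp (η * sq s m) /
      ∫ m', Real.exp (η * sq s m') ∂(surf n)) * e1
  simp_rw [e] at h2
  rw [integral_add (integrable_of_continuous (by fun_prop))
    (integrable_of_continuous (by fun_prop)), integral_dens_mul_linear,
    integral_dens_mul_linear] at h2
  linear_combination h2

lemma exists_sq_eq_half {s : Finset (Fin n)} {a b : Fin n} (ha : a ∈ s) (hb : b ∉ s) :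
    ∃ m : Sph n, sq s m = 1 / 2 := by
  have hab : a ≠ b := fun h => hb (h ▸ ha)
  have h2 : (√(1 / 2 : ℝ)) ^ 2 = 1 / 2 := Real.sq_sqrt (by norm_num)
  let x : EuclideanSpace ℝ (Fin n) :=
    WithLp.toLp 2 fun l => if l = a then √(1 / 2) else if l = b then √(1 / 2) else 0
  have hx : ‖x‖ = 1 := by
    rw [← sq_eq_sq₀ (norm_nonneg _) zero_le_one, EuclideanSpace.real_norm_sq_eq,
      Fintype.sum_eq_add a b hab]
    · simp only [x, if_true, hab.symm, if_false, h2]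
      norm_num
    · rintro l ⟨h1, h3⟩
      simp [x, h1, h3]
  refine ⟨⟨x, by simp [hx]⟩, ?_⟩
  unfold sq
  rw [Finset.sum_eq_single_of_mem a ha]
  · simp [x, crd]
  · intro l hl hla
    have : l ≠ b := fun h => hb (h ▸ hl)
    simp [x, crd, hla, this]

lemma exists_sq_eq_one {s : Finset (Fin n)} {a : Fin n} (ha : a ∈ s) :
    ∃ m : Sph n, sq s m = 1 := by
  refine ⟨⟨EuclideanSpace.single a 1, by simp⟩, ?_⟩
  unfold sq
  rw [Finset.sum_eq_single_of_mem a ha]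
  · simp [crd]
  · intro l hl hla
    simp [crd, hla]

lemma integral_dens_mul_pos [NeZero n] (s : Finset (Fin n)) (η : ℝ) {F : Sph n → ℝ}
    (hF : Continuous F) (h0 : ∀ m, 0 ≤ F m) {m : Sph n} (hm : F m ≠ 0) :
    0 < ∫ m, dens s η m * F m ∂(surf n) :=
  Continuous.integral_pos_of_hasCompactSupport_nonneg_nonzero (x := m) (by fun_prop)
    (HasCompactSupport.of_compactSpace _) (fun m => mul_nonneg (dens_pos s η m).le (h0 m))
    (mul_ne_zero (dens_pos s η m).ne' hm)

lemma mom_strictAnti [NeZero n] {s : Finset (Fin n)} {a b : Fin n} (ha : a ∈ s) (hb : b ∉ s)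
    (η : ℝ) (j : ℕ) : mom s η (j + 1) < mom s η j := by
  obtain ⟨m, hm⟩ := exists_sq_eq_half ha hb
  have h := integral_dens_mul_pos s η (F := fun m => 1 * sq s m ^ j + (-1) * sq s m ^ (j + 1))
    (by fun_prop) (fun m => by
      have h1 := mul_nonneg (pow_nonneg (sq_nonneg' s m) j) (sub_nonneg.2 (sq_le_one s m))
      have : 1 * sq s m ^ j + (-1) * sq s m ^ (j + 1) = sq s m ^ j * (1 - sq s m) := by ring
      linarith) (m := m) (by
      have : 1 * sq s m ^ j + (-1) * sq s m ^ (j + 1) = sq s m ^ j * (1 - sq s m) := by ring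
      rw [this, hm]
      positivity)
  rw [integral_dens_mul_linear] at h
  linarith

lemma integral_dens_mul_sub_sq [NeZero n] (s : Finset (Fin n)) (η : ℝ) :
    ∫ m, dens s η m * (sq s m - mom s η 1) ^ 2 ∂(surf n) = mom s η 2 - mom s η 1 ^ 2 := by
  have e : ∀ m, dens s η m * (sq s m - mom s η 1) ^ 2 =
      dens s η m * (1 * sq s m ^ 2 + (-2 * mom s η 1) * sq s m ^ 1) +
        dens s η m * (mom s η 1 ^ 2 * sq s m ^ 0 + 0 * sq s m ^ 0) := fun m => by ring
  simp_rw [e]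
  rw [integral_add (integrable_of_continuous (by fun_prop))
    (integrable_of_continuous (by fun_prop)), integral_dens_mul_linear,
    integral_dens_mul_linear, mom_zero]
  ring

/-- The function `sq s` takes both values `1 / 2` and `1`, and its mean can equal at most one of
them. -/
lemma mom_variance_pos [NeZero n] {s : Finset (Fin n)} {a b : Fin n} (ha : a ∈ s) (hb : b ∉ s)
    (η : ℝ) : 0 < mom s η 2 - mom s η 1 ^ 2 := by
  obtain ⟨m, hm⟩ := exists_sq_eq_half ha hb
  obtain ⟨m', hm'⟩ := exists_sq_eq_one ha
  rw [← integral_dens_mul_sub_sq]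
  by_cases h : sq s m - mom s η 1 = 0
  · refine integral_dens_mul_pos s η (by fun_prop) (fun _ => sq_nonneg _) (m := m')
      (pow_ne_zero 2 fun h' => ?_)
    linarith
  · exact integral_dens_mul_pos s η (by fun_prop) (fun _ => sq_nonneg _) (m := m)
      (pow_ne_zero 2 h)

/-- A product of one coordinate in `s` and one outside integrates to zero by rotating whichever
block has at least two coordinates, which is why `hd` is asked for. -/
lemma integral_dens_crd_two [NeZero n] (s : Finset (Fin n)) (η : ℝ) (hs : s.Nonempty)
    (hs' : sᶜ.Nonempty) (hd : 2 ≤ s.card ∨ 2 ≤ sᶜ.card) (a b : Fin n) :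
    ∫ m, dens s η m * (crd a m * crd b m) ∂(surf n) =
      if a = b then (if a ∈ s then mom s η 1 / s.card else (1 - mom s η 1) / sᶜ.card) else 0 := by
  have c1 : (s.card : ℝ) ≠ 0 := by exact_mod_cast hs.card_pos.ne'
  have c2 : (sᶜ.card : ℝ) ≠ 0 := by exact_mod_cast hs'.card_pos.ne'
  have mixed : ∀ a ∈ s, ∀ b ∉ s, ∫ m, dens s η m * (crd a m * crd b m) ∂(surf n) = 0 := by
    intro a ha b hb
    rcases hd with hd | hd
    · have := ((rotInv_dens s η).mul (rotInv_crd hb)).integral_crd ha hd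
      rw [← this]
      congr 1
      funext m
      ring
    · have := ((rotInv_compl_dens s η).mul (rotInv_crd (q := a) (by simpa using ha))).integral_crd
        (Finset.mem_compl.2 hb) hd
      rw [← this]
      congr 1
      funext m
      ring
  by_cases ha : a ∈ s <;> by_cases hb : b ∈ s
  · have h := (rotInv_dens s η).integral_crd_two ha hb
    simp only [eq_comm (a := a) (b := b), if_pos ha]
    have e : ∫ m, dens s η m * sq s m ∂(surf n) = mom s η 1 := by simp [mom]
    rw [e] at h
    simp only [kd, ite_mul, one_mul, zero_mul] at h
    split_ifs at h ⊢
    · rw [eq_div_iff c1, ← h, mul_comm]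
    · exact (mul_eq_zero.1 h).resolve_left c1
  · have hab : a ≠ b := fun h => hb (h ▸ ha)
    rw [if_neg hab, mixed a ha b hb]
  · have hab : a ≠ b := fun h => ha (h ▸ hb)
    rw [if_neg hab, ← mixed b hb a ha]
    congr 1
    funext m
    ring
  · have h := (rotInv_compl_dens s η).integral_crd_two (Finset.mem_compl.2 ha)
      (Finset.mem_compl.2 hb)
    simp only [eq_comm (a := a) (b := b), if_neg ha]
    have e : ∫ m, dens s η m * sq sᶜ m ∂(surf n) = 1 - mom s η 1 := by
      have e1 : ∀ m, dens s η m * sq sᶜ m =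
          dens s η m * (1 * sq s m ^ 0 + (-1) * sq s m ^ 1) := fun m => by
        rw [sq_compl]; ring
      simp_rw [e1, integral_dens_mul_linear, mom_zero]
      ring
    rw [e] at h
    simp only [kd, ite_mul, one_mul, zero_mul] at h
    split_ifs at h ⊢
    · rw [eq_div_iff c2, ← h, mul_comm]
    · exact (mul_eq_zero.1 h).resolve_left c2

/-! ### The Euler–Lagrange equation and the second variation. -/

lemma dotSq_eq_sum (m m' : Sph n) :
    dotSq m m' = ∑ a, ∑ b, crd a m * crd b m * (crd a m' * crd b m') := by
  unfold dotSq
  rw [PiLp.inner_apply, pow_two, Finset.sum_mul_sum]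
  refine Finset.sum_congr rfl fun a _ => Finset.sum_congr rfl fun b _ => ?_
  simp [crd]
  ring

lemma _root_.MeasureTheory.Integrable.continuous_mul {F φ : Sph n → ℝ}
    (hφ : Integrable φ (surf n)) (hF : Continuous F) :
    Integrable (fun m => F m * φ m) (surf n) := by
  obtain ⟨C, hC⟩ := (isCompact_range hF).isBounded.exists_norm_le
  exact hφ.bdd_mul hF.aestronglyMeasurable (Eventually.of_forall fun m => hC _ ⟨m, rfl⟩)

lemma integral_dotSq_mul {φ : Sph n → ℝ} (hφ : Integrable φ (surf n)) (m : Sph n) :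
    ∫ m', dotSq m m' * φ m' ∂(surf n) =
      ∑ a, ∑ b, crd a m * crd b m * ∫ m', crd a m' * crd b m' * φ m' ∂(surf n) := by
  have hi : ∀ a b : Fin n, Integrable (fun m' => crd a m * crd b m * (crd a m' * crd b m' * φ m'))
      (surf n) := fun a b => (hφ.continuous_mul (by fun_prop)).const_mul _
  simp_rw [dotSq_eq_sum, Finset.sum_mul, mul_assoc (crd _ m * crd _ m) (crd _ _ * crd _ _)]
  rw [integral_finsetSum _ fun a _ => integrable_finsetSum _ fun b _ => hi a b]
  simp_rw [integral_finsetSum _ fun b _ => hi _ b, integral_const_mul]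

/-- With `e = mom s η 1` and `k = s.card`, the potential of `dens s η` is affine in `sq s` with
slope `α (e / k - (1 - e) / (n - k))`, so this slope has to be `η`. The moment recursion with `j =
0`, `n e - k = 2 η (e - mom s η 2)`, derives this from `hα`. -/
lemma isCriticalPoint_dens [NeZero n] (s : Finset (Fin n)) (η α : ℝ) (hs : s.Nonempty)
    (hs' : sᶜ.Nonempty) (hd : 2 ≤ s.card ∨ 2 ≤ sᶜ.card)
    (hα : 2 * α * (mom s η 1 - mom s η 2) = s.card * (n - s.card)) :
    IsCriticalPoint n α (dens s η) := by
  have c1 : (s.card : ℝ) ≠ 0 := by exact_mod_cast hs.card_pos.ne'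
  have c2 : (sᶜ.card : ℝ) ≠ 0 := by exact_mod_cast hs'.card_pos.ne'
  have h1 := mom_recursion s η 0
  rw [mom_zero] at h1
  refine ⟨dens_pos s η, integral_dens s η, -Real.log (∫ m', Real.exp (η * sq s m') ∂(surf n)) -
    α * ((1 - mom s η 1) / sᶜ.card), fun m => ?_⟩
  rw [integral_dotSq_mul (integrable_of_continuous (continuous_dens s η))]
  simp_rw [mul_comm _ (dens s η _), integral_dens_crd_two s η hs hs' hd, mul_ite, mul_zero,
    Finset.sum_ite_eq, Finset.mem_univ, if_true]
  have e : ∑ a : Fin n, (if a ∈ s then crd a m * crd a m * (mom s η 1 / s.card)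
      else crd a m * crd a m * ((1 - mom s η 1) / sᶜ.card)) =
      sq s m * (mom s η 1 / s.card) + (1 - sq s m) * ((1 - mom s η 1) / sᶜ.card) := by
    rw [← sq_compl, ← Finset.sum_add_sum_compl s, sq, sq, Finset.sum_mul, Finset.sum_mul]
    congr 1
    · exact Finset.sum_congr rfl fun a ha => by rw [if_pos ha, pow_two]
    · exact Finset.sum_congr rfl fun a ha => by rw [if_neg (Finset.mem_compl.1 ha), pow_two]
  rw [e, dens, Real.log_div (Real.exp_ne_zero _) (integral_exp_sq_pos s η).ne', Real.log_exp]
  have e2 : η = α * (mom s η 1 / s.card - (1 - mom s η 1) / sᶜ.card) := by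
    rw [div_sub_div _ _ c1 c2, ← mul_div_assoc, eq_div_iff (mul_ne_zero c1 c2)]
    rw [card_compl_cast] at *
    push_cast at h1
    linear_combination (-η) * hα - α * h1
  linear_combination sq s m * e2

/-- The quadratic form `∑ M_ab m_a m_b`. -/
def quad (M : Fin n → Fin n → ℝ) (m : Sph n) : ℝ := ∑ a, ∑ b, M a b * (crd a m * crd b m)

@[fun_prop] lemma continuous_quad (M : Fin n → Fin n → ℝ) : Continuous (quad M) := by
  unfold quad
  fun_prop

lemma integral_quad_mul {φ : Sph n → ℝ} (hφ : Integrable φ (surf n)) (M : Fin n → Fin n → ℝ) :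
    ∫ m, quad M m * φ m ∂(surf n) =
      ∑ a, ∑ b, M a b * ∫ m, crd a m * crd b m * φ m ∂(surf n) := by
  have hi : ∀ a b : Fin n, Integrable (fun m' => M a b * (crd a m' * crd b m' * φ m'))
      (surf n) := fun a b => (hφ.continuous_mul (by fun_prop)).const_mul _
  simp_rw [quad, Finset.sum_mul, mul_assoc (M _ _) (crd _ _ * crd _ _)]
  rw [integral_finsetSum _ fun a _ => integrable_finsetSum _ fun b _ => hi a b]
  simp_rw [integral_finsetSum _ fun b _ => hi _ b, integral_const_mul]

/-- The subtracted average pairs to zero with the mean-zero `φ`, and expanding `(m · m')²` in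
coordinates turns the double integral into a sum of squares. -/
lemma secondVariation_eq {f φ : Sph n → ℝ} (hf : Continuous f) (hpos : ∀ m, 0 < f m)
    (hφ : Perturbation n φ) (α : ℝ) :
    secondVariation n α f φ = ∫ m, (f m)⁻¹ * φ m ^ 2 ∂(surf n) -
      α * ∑ a, ∑ b, (∫ m, crd a m * crd b m * φ m ∂(surf n)) ^ 2 := by
  have i1 : Integrable φ (surf n) := hφ.1.integrable one_le_two
  have hf' : Continuous fun m => (f m)⁻¹ := hf.inv₀ fun m => (hpos m).ne'
  have i2 : Integrable (fun m => (f m)⁻¹ * φ m ^ 2) (surf n) :=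
    hφ.1.integrable_sq.continuous_mul hf'
  set M : Fin n → Fin n → ℝ := fun a b => ∫ m, crd a m * crd b m * φ m ∂(surf n) with hM
  have i3 : Integrable (fun m => quad M m * φ m) (surf n) := i1.continuous_mul (by fun_prop)
  have e0 : ∀ m, ∫ m', dotSq m m' * φ m' ∂(surf n) = quad M m := fun m => by
    rw [integral_dotSq_mul i1]
    exact Finset.sum_congr rfl fun a _ => Finset.sum_congr rfl fun b _ => mul_comm _ _
  unfold secondVariation hessian
  generalize (⨍ m', preHessian n α f φ m' ∂(surf n)) = c
  have e : ∀ m, (preHessian n α f φ m - c) * φ m =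
      (f m)⁻¹ * φ m ^ 2 - α * (quad M m * φ m) - c * φ m := fun m => by
    rw [preHessian, e0]
    ring
  have i23 : Integrable (fun m => (f m)⁻¹ * φ m ^ 2 - α * (quad M m * φ m)) (surf n) :=
    i2.sub (i3.const_mul α)
  simp_rw [e]
  rw [integral_sub i23 (i1.const_mul c), integral_sub i2 (i3.const_mul α),
    integral_const_mul, integral_const_mul, hφ.2, integral_quad_mul i1]
  simp_rw [hM, pow_two]
  ring

/-- Take `M` to be the second moment matrix of `φ`; it is traceless because `φ` has mean zero, and
`∫ (quad M - c) φ = ∑ M_ab²` for every `c`. Expanding `∫ f (φ / f - α (quad M - c))² ≥ 0` then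
bounds the second variation below by `α` times the slack in the assumed inequality. -/
lemma isStable_of_quad_bound {f : Sph n → ℝ} {α : ℝ} (hα : 0 ≤ α) (hf : Continuous f)
    (hcrit : IsCriticalPoint n α f)
    (H : ∀ M : Fin n → Fin n → ℝ, (∀ a b, M a b = M b a) → ∑ a, M a a = 0 →
      ∃ c : ℝ, α * ∫ m, f m * (quad M m - c) ^ 2 ∂(surf n) ≤ ∑ a, ∑ b, M a b ^ 2) :
    IsStable n α f := by
  refine ⟨hcrit, fun φ hφ => ?_⟩
  have hpos := hcrit.1
  have i1 : Integrable φ (surf n) := hφ.1.integrable one_le_two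
  have hf' : Continuous fun m => (f m)⁻¹ := hf.inv₀ fun m => (hpos m).ne'
  have i2 : Integrable (fun m => (f m)⁻¹ * φ m ^ 2) (surf n) :=
    hφ.1.integrable_sq.continuous_mul hf'
  rw [secondVariation_eq hf hpos hφ]
  set M : Fin n → Fin n → ℝ := fun a b => ∫ m, crd a m * crd b m * φ m ∂(surf n) with hM
  have tr : ∑ a, M a a = 0 := by
    simp_rw [hM]
    rw [← integral_finsetSum _ fun a _ => i1.continuous_mul (by fun_prop), ← hφ.2]
    congr 1
    funext m
    rw [← Finset.sum_mul]
    simp_rw [← pow_two]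
    rw [show ∑ i, crd i m ^ 2 = 1 from sq_univ m, one_mul]
  obtain ⟨c, hc⟩ := H M (fun a b => by simp_rw [hM, mul_comm (crd a _)]) tr
  have i3 : Integrable (fun m => (quad M m - c) * φ m) (surf n) := i1.continuous_mul (by fun_prop)
  have i4 : Integrable (fun m => f m * (quad M m - c) ^ 2) (surf n) :=
    integrable_of_continuous (by fun_prop)
  have e3 : ∫ m, (quad M m - c) * φ m ∂(surf n) = ∑ a, ∑ b, M a b ^ 2 := by
    simp_rw [sub_mul]
    rw [integral_sub (i1.continuous_mul (by fun_prop)) (i1.const_mul c), integral_const_mul, hφ.2,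
      integral_quad_mul i1]
    simp_rw [hM, pow_two]
    ring
  have key : 0 ≤ ∫ m, ((f m)⁻¹ * φ m ^ 2 - 2 * α * ((quad M m - c) * φ m) +
      α ^ 2 * (f m * (quad M m - c) ^ 2)) ∂(surf n) := by
    refine integral_nonneg fun m => ?_
    have h0 := (hpos m).ne'
    have : (f m)⁻¹ * φ m ^ 2 - 2 * α * ((quad M m - c) * φ m) +
      α ^ 2 * (f m * (quad M m - c) ^ 2) = f m * ((f m)⁻¹ * φ m - α * (quad M m - c)) ^ 2 := by
      field_simp
      ring
    change 0 ≤ (f m)⁻¹ * φ m ^ 2 - 2 * α * ((quad M m - c) * φ m) +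
      α ^ 2 * (f m * (quad M m - c) ^ 2)
    rw [this]
    exact mul_nonneg (hpos m).le (sq_nonneg _)
  have i23 : Integrable (fun m => (f m)⁻¹ * φ m ^ 2 - 2 * α * ((quad M m - c) * φ m))
    (surf n) := i2.sub (i3.const_mul _)
  rw [integral_add i23 (i4.const_mul _), integral_sub i2 (i3.const_mul _),
    integral_const_mul, integral_const_mul, e3] at key
  have := mul_le_mul_of_nonneg_left hc hα
  linarith

/-- The perturbation is `φ = f ψ`. Keeping only the entries in `T` underestimates the subtracted sum
of squares, so the strict inequality still makes the second variation negative. -/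
lemma isUnstable_of_direction {f ψ : Sph n → ℝ} {α : ℝ} (hα : 0 ≤ α) (hf : Continuous f)
    (hcrit : IsCriticalPoint n α f) (hψ : Continuous ψ) (h0 : ∫ m, f m * ψ m ∂(surf n) = 0)
    (T : Finset (Fin n × Fin n))
    (h : ∫ m, f m * ψ m ^ 2 ∂(surf n) <
      α * ∑ p ∈ T, (∫ m, f m * (crd p.1 m * crd p.2 m * ψ m) ∂(surf n)) ^ 2) :
    IsUnstable n α f := by
  refine ⟨hcrit, fun hst => ?_⟩
  have hpos := hcrit.1
  have hφ : Perturbation n (fun m => f m * ψ m) := by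
    refine ⟨?_, h0⟩
    obtain ⟨C, hC⟩ := (isCompact_range (hf.mul hψ)).isBounded.exists_norm_le
    exact MemLp.of_bound (hf.mul hψ).aestronglyMeasurable C
      (Eventually.of_forall fun m => hC _ ⟨m, rfl⟩)
  have h1 := hst.2 _ hφ
  rw [secondVariation_eq hf hpos hφ] at h1
  have e1 : ∀ m, (f m)⁻¹ * (f m * ψ m) ^ 2 = f m * ψ m ^ 2 := fun m => by
    have := (hpos m).ne'
    field_simp
  have e2 : ∀ (a b : Fin n) (m : Sph n), crd a m * crd b m * (f m * ψ m) =
      f m * (crd a m * crd b m * ψ m) := fun a b m => by ring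
  simp_rw [e1, e2] at h1
  have h2 : ∑ p ∈ T, (∫ m, f m * (crd p.1 m * crd p.2 m * ψ m) ∂(surf n)) ^ 2 ≤
      ∑ a, ∑ b, (∫ m, f m * (crd a m * crd b m * ψ m) ∂(surf n)) ^ 2 := by
    rw [← Fintype.sum_prod_type'
      (f := fun a b => (∫ m, f m * (crd a m * crd b m * ψ m) ∂(surf n)) ^ 2)]
    exact Finset.sum_le_sum_of_subset_of_nonneg (Finset.subset_univ T)
      fun _ _ _ => sq_nonneg _
  have := mul_le_mul_of_nonneg_left h2 hα
  linarith

/-! ### Integrals of linear and quadratic forms on a block. -/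

/-- The linear form `∑_{a ∈ t} v_a m_a`. -/
def linOn (t : Finset (Fin n)) (v : Fin n → ℝ) (m : Sph n) : ℝ := ∑ a ∈ t, v a * crd a m

/-- The quadratic form `∑_{a, b ∈ t} N_ab m_a m_b`. -/
def quadOn (t : Finset (Fin n)) (N : Fin n → Fin n → ℝ) (m : Sph n) : ℝ :=
  ∑ a ∈ t, ∑ b ∈ t, N a b * (crd a m * crd b m)

@[fun_prop] lemma continuous_linOn (t : Finset (Fin n)) (v : Fin n → ℝ) :
    Continuous (linOn t v) := by
  unfold linOn
  fun_prop

@[fun_prop] lemma continuous_quadOn (t : Finset (Fin n)) (N : Fin n → Fin n → ℝ) :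
    Continuous (quadOn t N) := by
  unfold quadOn
  fun_prop

lemma integral_mul_linOn {G : Sph n → ℝ} (hG : Continuous G) (t : Finset (Fin n))
    (v : Fin n → ℝ) :
    ∫ m, G m * linOn t v m ∂(surf n) = ∑ a ∈ t, v a * ∫ m, G m * crd a m ∂(surf n) := by
  simp_rw [linOn, Finset.mul_sum, mul_left_comm (G _)]
  rw [integral_finsetSum _ fun a _ => integrable_of_continuous (by fun_prop)]
  simp_rw [integral_const_mul]

lemma integral_mul_quadOn {G : Sph n → ℝ} (hG : Continuous G) (t : Finset (Fin n))
    (N : Fin n → Fin n → ℝ) :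
    ∫ m, G m * quadOn t N m ∂(surf n) =
      ∑ a ∈ t, ∑ b ∈ t, N a b * ∫ m, G m * (crd a m * crd b m) ∂(surf n) := by
  simp_rw [quadOn, Finset.mul_sum, mul_left_comm (G _) (N _ _)]
  rw [integral_finsetSum _ fun a _ => integrable_of_continuous (by fun_prop)]
  refine Finset.sum_congr rfl fun a _ => ?_
  rw [integral_finsetSum _ fun b _ => integrable_of_continuous (by fun_prop)]
  simp_rw [integral_const_mul]

lemma RotInv.integral_linOn {t : Finset (Fin n)} {G : Sph n → ℝ} (hG : RotInv t G)
    (ht : 2 ≤ t.card) (v : Fin n → ℝ) : ∫ m, G m * linOn t v m ∂(surf n) = 0 := by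
  rw [integral_mul_linOn hG.1]
  exact Finset.sum_eq_zero fun a ha => by rw [hG.integral_crd ha ht, mul_zero]

lemma RotInv.integral_linOn_sq {t : Finset (Fin n)} {G : Sph n → ℝ} (hG : RotInv t G)
    (v : Fin n → ℝ) :
    t.card * ∫ m, G m * linOn t v m ^ 2 ∂(surf n) =
      (∑ a ∈ t, v a ^ 2) * ∫ m, G m * sq t m ∂(surf n) := by
  have g1 := hG.1
  simp_rw [pow_two (linOn t v _), ← mul_assoc]
  rw [integral_mul_linOn (by fun_prop), Finset.mul_sum, Finset.sum_mul]
  refine Finset.sum_congr rfl fun a ha => ?_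
  simp_rw [mul_right_comm (G _) (linOn t v _)]
  rw [integral_mul_linOn (by fun_prop), mul_left_comm, Finset.mul_sum]
  have e : ∀ b ∈ t, t.card * (v b * ∫ m, G m * crd a m * crd b m ∂(surf n)) =
      if a = b then v b * ∫ m, G m * sq t m ∂(surf n) else 0 := fun b hb => by
    have h := hG.integral_crd_two ha hb
    simp_rw [← mul_assoc (G _)] at h
    rw [mul_left_comm, h]
    simp only [kd, eq_comm (a := a) (b := b)]
    split_ifs <;> ring
  rw [Finset.sum_congr rfl e, Finset.sum_ite_eq, if_pos ha]
  ring

lemma RotInv.integral_quadOn {t : Finset (Fin n)} {G : Sph n → ℝ} (hG : RotInv t G)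
    (N : Fin n → Fin n → ℝ) :
    t.card * ∫ m, G m * quadOn t N m ∂(surf n) =
      (∑ a ∈ t, N a a) * ∫ m, G m * sq t m ∂(surf n) := by
  rw [integral_mul_quadOn hG.1, Finset.mul_sum, Finset.sum_mul]
  refine Finset.sum_congr rfl fun a ha => ?_
  rw [Finset.mul_sum]
  have e : ∀ b ∈ t, t.card * (N a b * ∫ m, G m * (crd a m * crd b m) ∂(surf n)) =
      if a = b then N a b * ∫ m, G m * sq t m ∂(surf n) else 0 := fun b hb => by
    rw [mul_left_comm, hG.integral_crd_two ha hb]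
    simp only [kd, eq_comm (a := a) (b := b)]
    split_ifs <;> ring
  rw [Finset.sum_congr rfl e, Finset.sum_ite_eq, if_pos ha]

lemma RotInv.integral_linOn_mul_quadOn {t : Finset (Fin n)} {G : Sph n → ℝ} (hG : RotInv t G)
    (ht : 2 ≤ t.card) (v : Fin n → ℝ) (N : Fin n → Fin n → ℝ) :
    ∫ m, G m * (linOn t v m * quadOn t N m) ∂(surf n) = 0 := by
  have g1 := hG.1
  simp_rw [← mul_assoc]
  rw [integral_mul_quadOn (by fun_prop)]
  refine Finset.sum_eq_zero fun a ha => Finset.sum_eq_zero fun b hb => ?_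
  simp_rw [mul_right_comm (G _) (linOn t v _)]
  rw [integral_mul_linOn (by fun_prop), mul_eq_zero]
  refine Or.inr (Finset.sum_eq_zero fun c hc => ?_)
  have h := hG.integral_crd_three ha hb hc ht
  simp_rw [← mul_assoc] at h ⊢
  rw [h, mul_zero]

lemma RotInv.integral_crd_two_mul_quadOn {t : Finset (Fin n)} {G : Sph n → ℝ}
    (hG : RotInv t G) {N : Fin n → Fin n → ℝ} (hN : ∀ a b, N a b = N b a) {a b : Fin n}
    (ha : a ∈ t) (hb : b ∈ t) :
    (t.card : ℝ) * (t.card + 2) *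
        ∫ m, G m * (crd a m * crd b m) * quadOn t N m ∂(surf n) =
      (kd a b * ∑ c ∈ t, N c c + 2 * N a b) * ∫ m, G m * sq t m ^ 2 ∂(surf n) := by
  have g1 := hG.1
  rw [integral_mul_quadOn (by fun_prop), Finset.mul_sum]
  have e : ∀ c ∈ t, (t.card : ℝ) * (t.card + 2) * (∑ d ∈ t,
      N c d * ∫ m, G m * (crd a m * crd b m) * (crd c m * crd d m) ∂(surf n)) =
      (kd a b * N c c + (if a = c then N c b else 0) + (if b = c then N c a else 0)) *
        ∫ m, G m * sq t m ^ 2 ∂(surf n) := by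
    intro c hc
    rw [Finset.mul_sum]
    have e1 : ∀ d ∈ t, (t.card : ℝ) * (t.card + 2) *
        (N c d * ∫ m, G m * (crd a m * crd b m) * (crd c m * crd d m) ∂(surf n)) =
        ((if c = d then kd a b * N c d else 0) + (if b = d then (if a = c then N c d else 0) else 0) +
          (if a = d then (if b = c then N c d else 0) else 0)) *
          ∫ m, G m * sq t m ^ 2 ∂(surf n) := by
      intro d hd
      have h := hG.integral_crd_four ha hb hc hd
      simp_rw [← mul_assoc] at h ⊢
      rw [mul_right_comm _ (N c d), h]
      simp only [kd, eq_comm (a := d), eq_comm (a := c) (b := a), eq_comm (a := b) (b := a),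
        eq_comm (a := c) (b := b)]
      split_ifs <;> ring
    rw [Finset.sum_congr rfl e1, ← Finset.sum_mul, Finset.sum_add_distrib, Finset.sum_add_distrib,
      Finset.sum_ite_eq, Finset.sum_ite_eq, Finset.sum_ite_eq, if_pos ha, if_pos hb, if_pos hc]
  rw [Finset.sum_congr rfl e, ← Finset.sum_mul, Finset.sum_add_distrib, Finset.sum_add_distrib,
      Finset.sum_ite_eq, Finset.sum_ite_eq, if_pos ha, if_pos hb, ← Finset.mul_sum, hN b a]
  ring

/-- Of the three pairings in the fourth moments, one produces the trace, which vanishes, and the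
other two agree by symmetry; hence the factor `2`. -/
lemma RotInv.integral_quadOn_sq {t : Finset (Fin n)} {G : Sph n → ℝ} (hG : RotInv t G)
    {N : Fin n → Fin n → ℝ} (hN : ∀ a b, N a b = N b a) (htr : ∑ a ∈ t, N a a = 0) :
    (t.card : ℝ) * (t.card + 2) * ∫ m, G m * quadOn t N m ^ 2 ∂(surf n) =
      2 * (∑ a ∈ t, ∑ b ∈ t, N a b ^ 2) * ∫ m, G m * sq t m ^ 2 ∂(surf n) := by
  have g1 := hG.1
  simp_rw [pow_two (quadOn t N _), ← mul_assoc]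
  rw [integral_mul_quadOn (by fun_prop), Finset.mul_sum, Finset.mul_sum, Finset.sum_mul]
  refine Finset.sum_congr rfl fun a ha => ?_
  rw [Finset.mul_sum, Finset.mul_sum, Finset.sum_mul]
  refine Finset.sum_congr rfl fun b hb => ?_
  simp_rw [mul_right_comm (G _) (quadOn t N _)]
  rw [mul_left_comm, hG.integral_crd_two_mul_quadOn hN ha hb, htr]
  ring

/-! ### Unstable directions. -/

/-- The direction is `ψ = m_a m_b` with `a ≠ b` in `s`. Put `c = ∫ f ψ²`; the entries `(a, b)` and
`(b, a)` each contribute `c²`, so instability means `2 α c > 1`. By the fourth moment formula this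
reads `(n - k) E u² > (k + 2) (E u - E u²)`, and by the recursion with `j = 1` the difference of the
two sides is `2 η (E u² - E u³) > 0`. -/
lemma isUnstable_dens_of_pos [NeZero n] {s : Finset (Fin n)} {η α : ℝ} (hη : 0 < η)
    (hs : 2 ≤ s.card) (hs' : sᶜ.Nonempty)
    (hα : 2 * α * (mom s η 1 - mom s η 2) = s.card * (n - s.card)) :
    IsUnstable n α (dens s η) := by
  obtain ⟨a, ha, b, hb, hab⟩ := Finset.one_lt_card.1 hs
  obtain ⟨q, hq⟩ := hs'
  have hsn : s.Nonempty := ⟨a, ha⟩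
  have hc1 : (0 : ℝ) < s.card := by exact_mod_cast hsn.card_pos
  have hc2 : (0 : ℝ) < n - s.card := by
    rw [← card_compl_cast]
    exact_mod_cast Finset.card_pos.2 ⟨q, hq⟩
  have hp := sub_pos.2 (mom_strictAnti ha (Finset.mem_compl.1 hq) η 1)
  have hp2 := sub_pos.2 (mom_strictAnti ha (Finset.mem_compl.1 hq) η 2)
  simp only [Nat.reduceAdd] at hp hp2
  have hα0 : 0 < α := by
    by_contra! h
    have := mul_pos hc1 hc2
    nlinarith
  have h0 : ∫ m, dens s η m * (crd a m * crd b m) ∂(surf n) = 0 := by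
    rw [integral_dens_crd_two s η hsn ⟨q, hq⟩ (Or.inl hs), if_neg hab]
  have h4 := (rotInv_dens s η).integral_crd_four ha hb ha hb
  have hk : kd b a * kd b a + kd a a * kd b b + kd b a * kd a b = 1 := by
    simp [kd, hab.symm]
  rw [hk, one_mul] at h4
  change _ = mom s η 2 at h4
  set c := ∫ m, dens s η m * (crd a m * (crd b m * (crd a m * crd b m))) ∂(surf n) with hc
  have hr := mom_recursion s η 1
  norm_num at hr
  refine isUnstable_of_direction hα0.le (continuous_dens s η)
    (isCriticalPoint_dens s η α hsn ⟨q, hq⟩ (Or.inl hs) hα) (by fun_prop) h0 {(a, b), (b, a)} ?_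
  have e1 : ∀ m, dens s η m * (crd a m * crd b m) ^ 2 =
      dens s η m * (crd a m * (crd b m * (crd a m * crd b m))) := fun m => by ring
  have e2 : ∀ m, dens s η m * (crd a m * crd b m * (crd a m * crd b m)) =
      dens s η m * (crd a m * (crd b m * (crd a m * crd b m))) := fun m => by ring
  have e3 : ∀ m, dens s η m * (crd b m * crd a m * (crd a m * crd b m)) =
      dens s η m * (crd a m * (crd b m * (crd a m * crd b m))) := fun m => by ring
  rw [Finset.sum_pair (by simp [hab])]
  simp_rw [e1, e2, e3, ← hc]
  have hm2 : 0 < mom s η 2 := by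
    have h1 := mul_pos hη hp2
    have h2 : 0 ≤ mom s η 3 := integral_nonneg fun m =>
      mul_nonneg (dens_pos s η m).le (pow_nonneg (sq_nonneg' s m) 3)
    linarith
  have hcpos : 0 < c := by
    have : 0 < (s.card : ℝ) * (s.card + 2) := by positivity
    exact pos_of_mul_pos_right (h4 ▸ hm2) this.le
  have h5 : 1 < 2 * α * c := by
    have h6 : (s.card + 2) * (mom s η 1 - mom s η 2) <
        (s.card + 2) * (mom s η 1 - mom s η 2) * (2 * α * c) := by
      have h7 : (s.card + 2) * (mom s η 1 - mom s η 2) * (2 * α * c) =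
          (n - s.card) * mom s η 2 := by
        linear_combination (s.card + 2) * c * hα + (n - s.card) * h4
      rw [h7]
      have := mul_pos hη hp2
      linarith
    exact (lt_mul_iff_one_lt_right (by positivity)).1 h6
  nlinarith

/-- The direction is `ψ = u - E u`, a change of the degree of concentration. With `V = Var u`, the
diagonal entries of its moment matrix are `V / k` on `s` and `-V / (n - k)` off `s`, so `hV` is the
criterion of `isUnstable_of_direction` after inserting `hα`. -/
lemma isUnstable_dens_of_variance [NeZero n] {s : Finset (Fin n)} {η α : ℝ}
    (hs : s.Nonempty) (hs' : sᶜ.Nonempty) (hd : 2 ≤ s.card ∨ 2 ≤ sᶜ.card)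
    (hα : 2 * α * (mom s η 1 - mom s η 2) = s.card * (n - s.card))
    (hV : 2 * (mom s η 1 - mom s η 2) < n * (mom s η 2 - mom s η 1 ^ 2)) :
    IsUnstable n α (dens s η) := by
  obtain ⟨a₀, ha₀⟩ := hs
  obtain ⟨q, hq⟩ := hs'
  have hc1 : (0 : ℝ) < s.card := by exact_mod_cast Finset.card_pos.2 ⟨a₀, ha₀⟩
  have hc2 : (0 : ℝ) < n - s.card := by
    rw [← card_compl_cast]
    exact_mod_cast Finset.card_pos.2 ⟨q, hq⟩
  have hp := sub_pos.2 (mom_strictAnti ha₀ (Finset.mem_compl.1 hq) η 1)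
  have hVp := mom_variance_pos ha₀ (Finset.mem_compl.1 hq) η
  simp only [Nat.reduceAdd] at hp
  have hα0 : 0 < α := by
    by_contra! h
    have := mul_pos hc1 hc2
    nlinarith
  set e := mom s η 1 with he
  set V := mom s η 2 - e ^ 2 with hVdef
  have i0 : ∫ m, dens s η m * (sq s m - e) ∂(surf n) = 0 := by
    have e1 : ∀ m, dens s η m * (sq s m - e) =
        dens s η m * (1 * sq s m ^ 1 + (-e) * sq s m ^ 0) := fun m => by ring
    simp_rw [e1, integral_dens_mul_linear, mom_zero, he]
    ring
  have i1 : ∫ m, dens s η m * (sq s m - e) * sq s m ∂(surf n) = V := by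
    have e1 : ∀ m, dens s η m * (sq s m - e) * sq s m =
        dens s η m * (1 * sq s m ^ 2 + (-e) * sq s m ^ 1) := fun m => by ring
    simp_rw [e1, integral_dens_mul_linear, ← he, hVdef]
    ring
  have i2 : ∫ m, dens s η m * (sq s m - e) * sq sᶜ m ∂(surf n) = -V := by
    have e1 : ∀ m, dens s η m * (sq s m - e) * sq sᶜ m =
        dens s η m * (sq s m - e) - dens s η m * (sq s m - e) * sq s m := fun m => by
      rw [sq_compl]; ring
    simp_rw [e1]
    rw [integral_sub (integrable_of_continuous (by fun_prop))
      (integrable_of_continuous (by fun_prop)), i0, i1, zero_sub]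
  have hsub : ∀ x : ℝ, HasDerivAt (fun x => x - e) ((fun _ => 1) x) x :=
    fun x => (hasDerivAt_id x).sub_const e
  have G1 : RotInv s (fun m => dens s η m * (sq s m - e)) :=
    (rotInv_dens s η).mul ((rotInv_sq s).comp hsub)
  have G2 : RotInv sᶜ (fun m => dens s η m * (sq s m - e)) :=
    (rotInv_compl_dens s η).mul ((rotInv_compl_sq s).comp hsub)
  refine isUnstable_of_direction hα0.le (continuous_dens s η)
    (isCriticalPoint_dens s η α ⟨a₀, ha₀⟩ ⟨q, hq⟩ hd hα) (by fun_prop) i0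
    Finset.univ.diag ?_
  rw [integral_dens_mul_sub_sq, Finset.sum_diag, ← Finset.sum_add_sum_compl s]
  have e3 : ∀ (a : Fin n) (m : Sph n), dens s η m * (crd a m * crd a m * (sq s m - e)) =
      dens s η m * (sq s m - e) * (crd a m * crd a m) := fun a m => by ring
  have s1 : ∀ a ∈ s, (∫ m, dens s η m * (crd a m * crd a m * (sq s m - e)) ∂(surf n)) ^ 2 =
      V ^ 2 / s.card ^ 2 := fun a ha => by
    have h := G1.integral_crd_two ha ha
    rw [i1] at h
    simp only [kd, if_true, one_mul] at h
    simp_rw [e3]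
    rw [← h]
    field_simp
  have s2 : ∀ a ∈ sᶜ, (∫ m, dens s η m * (crd a m * crd a m * (sq s m - e)) ∂(surf n)) ^ 2 =
      V ^ 2 / (n - s.card) ^ 2 := fun a ha => by
    have h := G2.integral_crd_two ha ha
    rw [i2, card_compl_cast] at h
    simp only [kd, if_true, one_mul] at h
    simp_rw [e3]
    rw [← neg_sq V, ← h]
    field_simp
  rw [Finset.sum_congr rfl s1, Finset.sum_congr rfl s2, Finset.sum_const, Finset.sum_const,
    nsmul_eq_mul, nsmul_eq_mul, card_compl_cast, ← he, ← hVdef]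
  have e4 : α * (s.card * (V ^ 2 / s.card ^ 2) + (n - s.card) * (V ^ 2 / (n - s.card) ^ 2)) =
      V * (n * V) / (2 * (e - mom s η 2)) := by
    have : α = s.card * (n - s.card) / (2 * (e - mom s η 2)) := by
      rw [eq_div_iff (by positivity), ← hα]
      ring
    rw [this]
    field_simp
    ring
  rw [e4, lt_div_iff₀ (by positivity)]
  exact mul_lt_mul_of_pos_left hV hVp

/-! ### Stability of the axisymmetric densities. -/

lemma integral_dens_mul_compl_sq_sq [NeZero n] (s : Finset (Fin n)) (η : ℝ) :
    ∫ m, dens s η m * sq sᶜ m ^ 2 ∂(surf n) = 1 - 2 * mom s η 1 + mom s η 2 := by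
  have e1 : ∀ m, dens s η m * sq sᶜ m ^ 2 = dens s η m * (1 * sq s m ^ 0 + (-2) * sq s m ^ 1) +
      dens s η m * (1 * sq s m ^ 2 + 0 * sq s m ^ 0) := fun m => by rw [sq_compl]; ring
  simp_rw [e1]
  rw [integral_add (integrable_of_continuous (by fun_prop))
      (integrable_of_continuous (by fun_prop)), integral_dens_mul_linear,
      integral_dens_mul_linear, mom_zero]
  ring

/-- A traceless form splits into a multiple of `u - E u`, the terms mixing the axis with its
complement, and a traceless form on the complement. These are orthogonal for the density, so the
bound required by `isStable_of_quad_bound` is checked on each of them. -/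
lemma isStable_dens_singleton [NeZero n] (hn : 3 ≤ n) (i₀ : Fin n) {η α : ℝ} (hη : 0 < η)
    (hα : 2 * α * (mom {i₀} η 1 - mom {i₀} η 2) = n - 1)
    (hV : n * (mom {i₀} η 2 - mom {i₀} η 1 ^ 2) ≤ 2 * (mom {i₀} η 1 - mom {i₀} η 2)) :
    IsStable n α (dens {i₀} η) := by
  set s : Finset (Fin n) := {i₀} with hs
  have hn' : (3 : ℝ) ≤ n := by exact_mod_cast hn
  have hscard : s.card = 1 := Finset.card_singleton i₀
  have htc : (sᶜ.card : ℝ) = n - 1 := by rw [card_compl_cast, hscard, Nat.cast_one]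
  have ht2 : 2 ≤ sᶜ.card := by
    rw [Finset.card_compl, hscard, Fintype.card_fin]
    omega
  obtain ⟨q, hq⟩ : sᶜ.Nonempty := Finset.card_pos.1 (by omega)
  have hi0 : i₀ ∈ s := Finset.mem_singleton_self _
  have hp := sub_pos.2 (mom_strictAnti hi0 (Finset.mem_compl.1 hq) η 1)
  have hp2 := sub_pos.2 (mom_strictAnti hi0 (Finset.mem_compl.1 hq) η 2)
  simp only [Nat.reduceAdd] at hp hp2
  have hα0 : 0 < α := by
    by_contra! h
    nlinarith
  refine isStable_of_quad_bound hα0.le (continuous_dens s η)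
    (isCriticalPoint_dens s η α ⟨i₀, hi0⟩ ⟨q, hq⟩ (Or.inr ht2) (by rw [hα, hscard]; simp)) ?_
  intro M hM htr
  set μ := M i₀ i₀ with hμ
  set e := mom s η 1 with he
  -- On the complement `M` has trace `-μ`; spreading `μ` over its `n - 1` diagonal entries makes the
  -- block traceless.
  let N : Fin n → Fin n → ℝ := fun a b => M a b + if a = b then μ / (n - 1) else 0
  have hN : ∀ a b, N a b = N b a := fun a b => by
    simp only [N, hM a b, eq_comm (a := a) (b := b)]
  have htrt : ∑ a ∈ sᶜ, M a a = -μ := by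
    rw [Fintype.sum_eq_add_sum_compl i₀] at htr
    linarith
  have hn1 : (n : ℝ) - 1 ≠ 0 := by linarith
  have hNtr : ∑ a ∈ sᶜ, N a a = 0 := by
    simp only [N, if_true]
    rw [Finset.sum_add_distrib, htrt, Finset.sum_const, nsmul_eq_mul, htc]
    field_simp
    ring
  have hNsq : ∑ a ∈ sᶜ, ∑ b ∈ sᶜ, N a b ^ 2 =
      ∑ a ∈ sᶜ, ∑ b ∈ sᶜ, M a b ^ 2 - μ ^ 2 / (n - 1) := by
    have e1 : ∀ a ∈ sᶜ, ∑ b ∈ sᶜ, N a b ^ 2 =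
        ∑ b ∈ sᶜ, M a b ^ 2 + (2 * (μ / (n - 1)) * M a a + (μ / (n - 1)) ^ 2) := fun a ha => by
      have e2 : ∀ b ∈ sᶜ, N a b ^ 2 = M a b ^ 2 +
          if a = b then 2 * (μ / (n - 1)) * M a b + (μ / (n - 1)) ^ 2 else 0 := fun b _ => by
        simp only [N]
        split_ifs <;> ring
      rw [Finset.sum_congr rfl e2, Finset.sum_add_distrib, Finset.sum_ite_eq, if_pos ha]
    rw [Finset.sum_congr rfl e1, Finset.sum_add_distrib, Finset.sum_add_distrib,
      ← Finset.mul_sum, htrt, Finset.sum_const, nsmul_eq_mul, htc]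
    field_simp
    ring
  have hMsq : ∑ a, ∑ b, M a b ^ 2 =
      μ ^ 2 + 2 * ∑ b ∈ sᶜ, M i₀ b ^ 2 + ∑ a ∈ sᶜ, ∑ b ∈ sᶜ, M a b ^ 2 := by
    simp_rw [Fintype.sum_eq_add_sum_compl i₀, Finset.sum_add_distrib, hM _ i₀]
    ring
  have hu : ∀ m, crd i₀ m * crd i₀ m = sq s m := fun m => by
    rw [sq, hs, Finset.sum_singleton, pow_two]
  set κ := μ * n / (n - 1) with hκ
  have hquad : ∀ m, quad M m - μ * (n * e - 1) / (n - 1) =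
      κ * (sq s m - e) + 2 * (crd i₀ m * linOn sᶜ (M i₀) m) + quadOn sᶜ N m := by
    intro m
    have q1 : quadOn sᶜ N m = quadOn sᶜ M m + μ / (n - 1) * (1 - sq s m) := by
      rw [← sq_compl, quadOn, quadOn, sq, Finset.mul_sum, ← Finset.sum_add_distrib]
      refine Finset.sum_congr rfl fun a ha => ?_
      have e2 : ∀ b ∈ sᶜ, N a b * (crd a m * crd b m) = M a b * (crd a m * crd b m) +
          if a = b then μ / (n - 1) * (crd a m * crd b m) else 0 := fun b _ => by
        simp only [N]
        split_ifs <;> ring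
      rw [Finset.sum_congr rfl e2, Finset.sum_add_distrib, Finset.sum_ite_eq, if_pos ha]
      ring
    have q2 : quad M m = μ * sq s m + 2 * (crd i₀ m * linOn sᶜ (M i₀) m) + quadOn sᶜ M m := by
      have e3 : ∑ a ∈ sᶜ, M i₀ a * (crd a m * crd i₀ m) = crd i₀ m * linOn sᶜ (M i₀) m := by
        rw [linOn, Finset.mul_sum]
        exact Finset.sum_congr rfl fun a _ => by ring
      have e4 : ∑ a ∈ sᶜ, M i₀ a * (crd i₀ m * crd a m) = crd i₀ m * linOn sᶜ (M i₀) m := by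
        rw [← e3]
        exact Finset.sum_congr rfl fun a _ => by ring
      simp_rw [quad, Fintype.sum_eq_add_sum_compl i₀, Finset.sum_add_distrib, hM _ i₀, ← hs]
      rw [e3, e4, hu, quadOn]
      ring
    rw [q2, q1, hκ]
    field_simp
    ring
  -- This constant is the mean of `quad M` for the density.
  refine ⟨μ * (n * e - 1) / (n - 1), ?_⟩
  have hsub : ∀ x : ℝ, HasDerivAt (fun x => x - e) ((fun _ => 1) x) x :=
    fun x => (hasDerivAt_id x).sub_const e
  have hD := rotInv_compl_dens s η
  have hX : RotInv sᶜ (crd i₀) := rotInv_crd (by simpa using hi0)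
  have hU : RotInv sᶜ (fun m => sq s m - e) := (rotInv_compl_sq s).comp hsub
  have j1 := integral_dens_mul_sub_sq s η
  rw [← he] at j1
  have j2 := (hD.mul (hX.mul hX)).integral_linOn_sq (M i₀)
  have j3 := hD.integral_quadOn_sq hN hNtr
  have j4 := (hD.mul (hU.mul hX)).integral_linOn ht2 (M i₀)
  have j5 := (hD.mul hU).integral_quadOn N
  have j6 := (hD.mul hX).integral_linOn_mul_quadOn ht2 (M i₀) N
  have k2 : ∫ m, dens s η m * (crd i₀ m * crd i₀ m) * sq sᶜ m ∂(surf n) =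
      e - mom s η 2 := by
    have e1 : ∀ m, dens s η m * (crd i₀ m * crd i₀ m) * sq sᶜ m =
        dens s η m * (1 * sq s m ^ 1 + (-1) * sq s m ^ 2) := fun m => by
      rw [hu, sq_compl]; ring
    simp_rw [e1, integral_dens_mul_linear]
    ring
  rw [k2, htc] at j2
  rw [integral_dens_mul_compl_sq_sq, htc] at j3
  rw [hNtr, zero_mul, htc] at j5
  replace j5 := (mul_eq_zero.1 j5).resolve_left hn1
  -- The cross terms vanish: `j4` and `j6` are odd in the complementary coordinates, and `j5` has a
  -- traceless form.
  have total : ∫ m, dens s η m * (quad M m - μ * (n * e - 1) / (n - 1)) ^ 2 ∂(surf n) =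
      κ ^ 2 * (mom s η 2 - e ^ 2) +
      4 * ∫ m, dens s η m * (crd i₀ m * crd i₀ m) * linOn sᶜ (M i₀) m ^ 2 ∂(surf n) +
      ∫ m, dens s η m * quadOn sᶜ N m ^ 2 ∂(surf n) := by
    have e1 : ∀ m, dens s η m * (quad M m - μ * (n * e - 1) / (n - 1)) ^ 2 =
        κ ^ 2 * (dens s η m * (sq s m - e) ^ 2) +
        4 * (dens s η m * (crd i₀ m * crd i₀ m) * linOn sᶜ (M i₀) m ^ 2) +
        dens s η m * quadOn sᶜ N m ^ 2 +
        4 * κ * (dens s η m * ((sq s m - e) * crd i₀ m) * linOn sᶜ (M i₀) m) +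
        2 * κ * (dens s η m * (sq s m - e) * quadOn sᶜ N m) +
        4 * (dens s η m * crd i₀ m * (linOn sᶜ (M i₀) m * quadOn sᶜ N m)) := fun m => by
      rw [hquad]; ring
    simp_rw [e1]
    rw [integral_add, integral_add, integral_add, integral_add, integral_add]
    · simp_rw [integral_const_mul, j4, j5, j6]
      rw [j1]
      ring
    all_goals exact integrable_of_continuous (by fun_prop)
  have hr0 := mom_recursion s η 0
  have hr := mom_recursion s η 1
  rw [mom_zero, hscard] at hr0
  rw [hscard] at hr
  norm_num at hr hr0
  have hηp := mul_pos hη hp2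
  rw [hNsq] at j3
  have hS3 : 0 ≤ ∑ a ∈ sᶜ, ∑ b ∈ sᶜ, M a b ^ 2 - μ ^ 2 / (n - 1) := by
    rw [← hNsq]
    exact Finset.sum_nonneg fun _ _ => Finset.sum_nonneg fun _ _ => sq_nonneg _
  rw [total, hMsq]
  rw [← he] at j3 hr hr0
  generalize ∫ m, dens s η m * (crd i₀ m * crd i₀ m) * linOn sᶜ (M i₀) m ^ 2 ∂(surf n) = I₂ at j2 ⊢
  generalize ∫ m, dens s η m * quadOn sᶜ N m ^ 2 ∂(surf n) = I₃ at j3 ⊢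
  generalize ∑ a ∈ sᶜ, ∑ b ∈ sᶜ, M a b ^ 2 = S₃ at *
  generalize ∑ b ∈ sᶜ, M i₀ b ^ 2 = S₂ at *
  have hn1p : (0 : ℝ) < n - 1 := by linarith
  have B1 : α * (κ ^ 2 * (mom s η 2 - e ^ 2)) ≤ μ ^ 2 * n / (n - 1) := by
    have h1 : α * (κ ^ 2 * (mom s η 2 - e ^ 2)) =
        μ ^ 2 * n / (n - 1) ^ 2 * (α * (n * (mom s η 2 - e ^ 2))) := by
      rw [hκ, div_pow]; ring
    have h2 : μ ^ 2 * n / (n - 1) = μ ^ 2 * n / (n - 1) ^ 2 * (n - 1) := by field_simp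
    rw [h1, h2]
    refine mul_le_mul_of_nonneg_left ?_ (by positivity)
    rw [← hα]
    calc α * (n * (mom s η 2 - e ^ 2)) ≤ α * (2 * (e - mom s η 2)) :=
          mul_le_mul_of_nonneg_left hV hα0.le
      _ = _ := by ring
  -- Equality holds here: tilting the axis moves along the `O(n)`-orbit of critical points.
  have B2 : α * (4 * I₂) = 2 * S₂ := by
    refine mul_left_cancel₀ hn1 ?_
    linear_combination 4 * α * j2 + 2 * S₂ * hα
  have B3 : α * I₃ ≤ S₃ - μ ^ 2 / (n - 1) := by
    have h3 : 0 ≤ e - 2 * mom s η 2 + mom s η 3 := by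
      have e1 : ∀ m, dens s η m * (sq s m * (1 - sq s m) ^ 2) =
          dens s η m * (1 * sq s m ^ 1 + (-2) * sq s m ^ 2) +
            dens s η m * (1 * sq s m ^ 3 + 0 * sq s m ^ 0) := fun m => by ring
      have h4 : 0 ≤ ∫ m, dens s η m * (sq s m * (1 - sq s m) ^ 2) ∂(surf n) :=
        integral_nonneg fun m => mul_nonneg (dens_pos s η m).le
          (mul_nonneg (sq_nonneg' s m) (sq_nonneg _))
      simp_rw [e1] at h4
      rw [integral_add (integrable_of_continuous (by fun_prop))
        (integrable_of_continuous (by fun_prop)), integral_dens_mul_linear,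
        integral_dens_mul_linear, ← he] at h4
      linarith
    -- Subtracting the recursions for `j = 0` and `j = 1` shows that the gap is `2 η E[u (1 - u)²]`;
    -- here `η > 0` is needed.
    have h5 : 1 - 2 * e + mom s η 2 ≤ (n - 1 + 2) * (e - mom s η 2) := by
      have := mul_nonneg hη.le h3
      linarith
    have h6 := mul_le_mul_of_nonneg_left h5 (mul_nonneg hα0.le hS3)
    have h7 : (0 : ℝ) < (n - 1) * (n - 1 + 2) := by positivity
    refine le_of_mul_le_mul_left ?_ h7
    have h8 : (n - 1) * (n - 1 + 2) * (α * I₃) =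
        2 * (α * (S₃ - μ ^ 2 / (n - 1)) * (1 - 2 * e + mom s η 2)) := by
      linear_combination α * j3
    rw [h8]
    calc 2 * (α * (S₃ - μ ^ 2 / (n - 1)) * (1 - 2 * e + mom s η 2))
        ≤ 2 * (α * (S₃ - μ ^ 2 / (n - 1)) * ((n - 1 + 2) * (e - mom s η 2))) := by linarith
      _ = _ := by linear_combination (S₃ - μ ^ 2 / (n - 1)) * (n - 1 + 2) * hα
  have h9 : μ ^ 2 * n / (n - 1) - μ ^ 2 / (n - 1) = μ ^ 2 := by
    field_simp
  rw [mul_add, mul_add, B2]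
  linarith

/-! ### Angular integrals as sphere averages, and `σ_k` in terms of moments. -/

/-- Functionals on the continuous functions that are linear and monotone on `[0, 1]`. -/
structure IsMeanOnUnit (L : (ℝ → ℝ) → ℝ) : Prop where
  add : ∀ F G : ℝ → ℝ, Continuous F → Continuous G → L (fun x => F x + G x) = L F + L G
  smul : ∀ (c : ℝ) (F : ℝ → ℝ), L (fun x => c * F x) = c * L F
  mono : ∀ F G : ℝ → ℝ, Continuous F → Continuous G → (∀ x ∈ Set.Icc (0 : ℝ) 1, F x ≤ G x) →
    L F ≤ L G

/-- The functionals agree on polynomials, which are uniformly dense on `[0, 1]` by Weierstrass, and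
monotonicity controls the error. -/
lemma IsMeanOnUnit.eq_of_moments {L₁ L₂ : (ℝ → ℝ) → ℝ} (h₁ : IsMeanOnUnit L₁)
    (h₂ : IsMeanOnUnit L₂) (h : ∀ p : ℕ, L₁ (fun x => x ^ p) = L₂ (fun x => x ^ p))
    {F : ℝ → ℝ} (hF : Continuous F) : L₁ F = L₂ F := by
  have hpoly : ∀ q : Polynomial ℝ, L₁ (fun x => q.eval x) = L₂ (fun x => q.eval x) := by
    intro q
    induction q using Polynomial.induction_on' with
    | add p q hp hq =>
      simp_rw [Polynomial.eval_add]
      rw [h₁.add _ _ p.continuous q.continuous, h₂.add _ _ p.continuous q.continuous, hp, hq]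
    | monomial p a =>
      simp_rw [Polynomial.eval_monomial]
      rw [h₁.smul, h₂.smul, h]
  have key : ∀ {L L' : (ℝ → ℝ) → ℝ}, IsMeanOnUnit L → IsMeanOnUnit L' →
      (∀ q : Polynomial ℝ, L (fun x => q.eval x) = L' (fun x => q.eval x)) → L F ≤ L' F := by
    intro L L' hL hL' hq
    have hone : L (fun _ => 1) = L' (fun _ => 1) := by simpa using hq 1
    have hone0 : 0 ≤ L' (fun _ => 1) := by
      have h0 := hL'.smul 0 (fun _ => 0)
      have h1 := hL'.mono (fun _ => 0 * 0) (fun _ => 1) (by fun_prop) (by fun_prop) (by simp)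
      linarith
    refine le_of_forall_pos_le_add fun ε hε => ?_
    -- The error `δ L'(1)` occurs twice; the `+ 1` keeps the denominator positive when `L'(1) = 0`.
    set δ := ε / (2 * L' (fun _ => 1) + 1) with hδ
    have hδ0 : 0 < δ := by positivity
    obtain ⟨q, hq'⟩ := exists_polynomial_near_of_continuousOn 0 1 F hF.continuousOn δ hδ0
    have a1 := hL.mono F (fun x => q.eval x + δ * 1) hF (by fun_prop)
      fun x hx => by linarith [(abs_lt.1 (hq' x hx)).1]
    have a2 := hL'.mono (fun x => q.eval x) (fun x => F x + δ * 1) (by fun_prop) (by fun_prop)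
      fun x hx => by linarith [(abs_lt.1 (hq' x hx)).2]
    rw [hL.add _ _ (by fun_prop) (by fun_prop), hL.smul, hone, hq] at a1
    rw [hL'.add _ _ hF (by fun_prop), hL'.smul] at a2
    have a3 : δ * (2 * L' (fun _ => 1) + 1) = ε := div_mul_cancel₀ _ (by positivity)
    linarith
  exact le_antisymm (key h₁ h₂ hpoly) (key h₂ h₁ fun q => (hpoly q).symm)

/-- The integral of `F (sin² θ)` for the weight `sin^a θ cos^b θ` on `[0, π / 2]`. -/
def angular (a b : ℕ) (F : ℝ → ℝ) : ℝ :=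
  ∫ θ in (0 : ℝ)..(Real.pi / 2),
    F (Real.sin θ ^ 2) * (Real.sin θ ^ a * Real.cos θ ^ b)

lemma angular_weight_nonneg (a b : ℕ) {θ : ℝ} (hθ : θ ∈ Set.Icc 0 (Real.pi / 2)) :
    0 ≤ Real.sin θ ^ a * Real.cos θ ^ b :=
  mul_nonneg (pow_nonneg (Real.sin_nonneg_of_mem_Icc ⟨hθ.1, by linarith [hθ.2, Real.pi_pos]⟩) _)
    (pow_nonneg (Real.cos_nonneg_of_mem_Icc ⟨by linarith [hθ.1, Real.pi_pos], hθ.2⟩) _)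

lemma isMeanOnUnit_angular (a b : ℕ) : IsMeanOnUnit (angular a b) where
  add F G hF hG := by
    unfold angular
    simp_rw [add_mul]
    exact intervalIntegral.integral_add (Continuous.intervalIntegrable (by fun_prop) _ _)
      (Continuous.intervalIntegrable (by fun_prop) _ _)
  smul c F := by
    unfold angular
    simp_rw [mul_assoc c]
    exact intervalIntegral.integral_const_mul _ _
  mono F G hF hG h := by
    unfold angular
    refine intervalIntegral.integral_mono_on (by positivity)
      (Continuous.intervalIntegrable (by fun_prop) _ _)
      (Continuous.intervalIntegrable (by fun_prop) _ _) fun θ hθ => ?_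
    exact mul_le_mul_of_nonneg_right (h _ ⟨sq_nonneg _, Real.sin_sq_le_one θ⟩)
      (angular_weight_nonneg a b hθ)

lemma angular_one_pos (a b : ℕ) : 0 < angular a b (fun _ => 1) := by
  unfold angular
  refine intervalIntegral.intervalIntegral_pos_of_pos_on
    (Continuous.intervalIntegrable (by fun_prop) _ _) (fun θ hθ => ?_) (by positivity)
  rw [one_mul]
  exact mul_pos (pow_pos (Real.sin_pos_of_mem_Ioo ⟨hθ.1, by linarith [hθ.2, Real.pi_pos]⟩) _)
    (pow_pos (Real.cos_pos_of_mem_Ioo ⟨by linarith [hθ.1, Real.pi_pos], hθ.2⟩) _)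

/-- Integrate the derivative of `sin^(2p+a+1) θ cos^(b+1) θ`, which vanishes at both ends. -/
lemma angular_recursion (a b p : ℕ) :
    (a + b + 2 + 2 * p : ℝ) * angular a b (fun x => x ^ (p + 1)) =
      (a + 1 + 2 * p) * angular a b (fun x => x ^ p) := by
  have hd : ∀ θ : ℝ, HasDerivAt (fun θ => Real.sin θ ^ (2 * p + a + 1) * Real.cos θ ^ (b + 1))
      ((a + 1 + 2 * p) * ((Real.sin θ ^ 2) ^ p * (Real.sin θ ^ a * Real.cos θ ^ b)) -
        (a + b + 2 + 2 * p) * ((Real.sin θ ^ 2) ^ (p + 1) * (Real.sin θ ^ a * Real.cos θ ^ b)))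
      θ := by
    intro θ
    have h := ((Real.hasDerivAt_sin θ).fun_pow (2 * p + a + 1)).fun_mul
      ((Real.hasDerivAt_cos θ).fun_pow (b + 1))
    refine h.congr_deriv ?_
    simp only [Nat.add_sub_cancel]
    push_cast
    have hc : Real.cos θ ^ 2 = 1 - Real.sin θ ^ 2 := Real.cos_sq' θ
    linear_combination ((2 * p + a + 1) * Real.sin θ ^ (2 * p + a) * Real.cos θ ^ b) * hc
  have h := intervalIntegral.integral_eq_sub_of_hasDerivAt (a := 0) (b := Real.pi / 2)
    (fun θ _ => hd θ) (Continuous.intervalIntegrable (by fun_prop) _ _)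
  rw [intervalIntegral.integral_sub (Continuous.intervalIntegrable (by fun_prop) _ _)
    (Continuous.intervalIntegrable (by fun_prop) _ _), intervalIntegral.integral_const_mul,
    intervalIntegral.integral_const_mul] at h
  simp only [Real.cos_pi_div_two, Real.sin_zero, zero_pow (Nat.succ_ne_zero _), mul_zero,
    zero_mul, sub_zero] at h
  unfold angular
  linarith

lemma isMeanOnUnit_dens [NeZero n] (s : Finset (Fin n)) (η : ℝ) :
    IsMeanOnUnit fun F => ∫ m, dens s η m * F (sq s m) ∂(surf n) where
  add F G hF hG := by
    simp_rw [mul_add]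
    exact integral_add (integrable_of_continuous (by fun_prop))
      (integrable_of_continuous (by fun_prop))
  smul c F := by
    simp_rw [mul_left_comm _ c]
    exact integral_const_mul _ _
  mono F G hF hG h :=
    integral_mono (integrable_of_continuous (by fun_prop))
      (integrable_of_continuous (by fun_prop)) fun m =>
        mul_le_mul_of_nonneg_left (h _ ⟨sq_nonneg' s m, sq_le_one s m⟩) (dens_pos s η m).le

/-- Both sides equal `1` for `p = 0` and obey the same recursion, so no change to polar coordinates
is needed. -/
lemma mom_zero_eq_angular [NeZero n] (s : Finset (Fin n)) (a b p : ℕ) (ha : s.card = a + 1)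
    (hb : n = a + b + 2) :
    mom s 0 p = (angular a b (fun _ => 1))⁻¹ * angular a b (fun x => x ^ p) := by
  induction p with
  | zero =>
    rw [mom_zero]
    simp only [pow_zero]
    exact (inv_mul_cancel₀ (angular_one_pos a b).ne').symm
  | succ p ih =>
    have h1 := mom_recursion s 0 p
    have h2 := angular_recursion a b p
    have hn : (n : ℝ) = a + b + 2 := by rw [hb]; push_cast; ring
    rw [ih, ha, hn] at h1
    push_cast at h1
    have h3 : (a + b + 2 + 2 * p : ℝ) ≠ 0 := by positivity
    refine mul_left_cancel₀ h3 ?_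
    linear_combination h1 - (angular a b (fun _ => 1))⁻¹ * h2

lemma integral_dens_zero_eq_angular [NeZero n] (s : Finset (Fin n)) (a b : ℕ)
    (ha : s.card = a + 1) (hb : n = a + b + 2) {F : ℝ → ℝ} (hF : Continuous F) :
    ∫ m, dens s 0 m * F (sq s m) ∂(surf n) =
      (angular a b (fun _ => 1))⁻¹ * angular a b F := by
  have hm := isMeanOnUnit_angular a b
  have h2 : IsMeanOnUnit fun F => (angular a b (fun _ => 1))⁻¹ * angular a b F :=
    { add := fun F G hF hG => by rw [hm.add F G hF hG, mul_add]
      smul := fun c F => by rw [hm.smul]; ring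
      mono := fun F G hF hG h => mul_le_mul_of_nonneg_left (hm.mono F G hF hG h)
        (inv_nonneg.2 (angular_one_pos a b).le) }
  exact (isMeanOnUnit_dens s 0).eq_of_moments h2
    (fun p => mom_zero_eq_angular s a b p ha hb) hF

/-- Writing `dens s η` as a reweighting of the uniform density `dens s 0` makes the comparison at `η
= 0` sufficient for all `η`. -/
lemma integral_dens_mul_eq [NeZero n] (s : Finset (Fin n)) (η : ℝ) {F : Sph n → ℝ} :
    ∫ m, dens s η m * F m ∂(surf n) =
      (∫ m, dens s 0 m * (Real.exp (η * sq s m) * F m) ∂(surf n)) /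
        ∫ m, dens s 0 m * Real.exp (η * sq s m) ∂(surf n) := by
  have h0 := integral_exp_sq_pos s 0
  have e1 : ∀ m, dens s 0 m * (Real.exp (η * sq s m) * F m) =
      (∫ m', Real.exp (0 * sq s m') ∂(surf n))⁻¹ * (Real.exp (η * sq s m) * F m) := fun m => by
    simp [dens]
  have e2 : ∀ m, dens s 0 m * Real.exp (η * sq s m) =
      (∫ m', Real.exp (0 * sq s m') ∂(surf n))⁻¹ * Real.exp (η * sq s m) := fun m => by
    simp [dens]
  simp_rw [e1, e2, integral_const_mul]
  rw [mul_div_mul_left _ _ (inv_ne_zero h0.ne'), ← integral_div]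
  unfold dens
  simp_rw [div_mul_eq_mul_div]

lemma sigma_eq [NeZero n] (s : Finset (Fin n)) (k : ℕ) (hk : 1 ≤ k) (hkn : k < n)
    (hs : s.card = k) (η : ℝ) :
    sigma n k η = (k * (n - k)) / (2 * (mom s η 1 - mom s η 2)) := by
  obtain ⟨a, rfl⟩ := Nat.exists_eq_add_of_le' hk
  obtain ⟨b, hb⟩ := Nat.exists_eq_add_of_lt hkn
  have hb' : n = a + b + 2 := by omega
  have e1 : n - (a + 1) - 1 = b := by omega
  have h1 := integral_dens_zero_eq_angular s a b hs hb' (F := fun x => Real.exp (η * x))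
    (by fun_prop)
  have h2 := integral_dens_zero_eq_angular s a b hs hb'
    (F := fun x => Real.exp (η * x) * (1 * x ^ 1 + (-1) * x ^ 2)) (by fun_prop)
  have h3 := integral_dens_mul_eq s η (F := fun m => 1 * sq s m ^ 1 + (-1) * sq s m ^ 2)
  rw [integral_dens_mul_linear, h1, h2,
    mul_div_mul_left _ _ (inv_ne_zero (angular_one_pos a b).ne')] at h3
  have h4 : mom s η 1 - mom s η 2 = angular a b
      (fun x => Real.exp (η * x) * (1 * x ^ 1 + (-1) * x ^ 2)) /
        angular a b (fun x => Real.exp (η * x)) := by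
    rw [← h3]; ring
  have h5 : ∀ θ : ℝ, Real.exp (η * Real.sin θ ^ 2) * Real.sin θ ^ 2 * Real.cos θ ^ 2 *
      (Real.sin θ ^ a * Real.cos θ ^ b) = Real.exp (η * Real.sin θ ^ 2) *
        (1 * (Real.sin θ ^ 2) ^ 1 + (-1) * (Real.sin θ ^ 2) ^ 2) *
        (Real.sin θ ^ a * Real.cos θ ^ b) := fun θ => by
    rw [Real.cos_sq']; ring
  rw [h4]
  unfold sigma angular
  rw [e1, Nat.add_sub_cancel]
  simp_rw [h5]
  rw [← mul_div_assoc, div_div_eq_mul_div, mul_comm (((a + 1 : ℕ) : ℝ)) _]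

/-! ### Dependence of the moments on `η`, and unimodality. -/

lemma hasDerivAt_integral_exp_sq [NeZero n] (s : Finset (Fin n)) (j : ℕ) (η : ℝ) :
    HasDerivAt (fun η => ∫ m, Real.exp (η * sq s m) * sq s m ^ j ∂(surf n))
      (∫ m, Real.exp (η * sq s m) * sq s m ^ (j + 1) ∂(surf n)) η := by
  refine (hasDerivAt_integral_of_dominated_loc_of_deriv_le (μ := surf n) (x₀ := η)
    (F := fun η m => Real.exp (η * sq s m) * sq s m ^ j)
    (F' := fun η m => Real.exp (η * sq s m) * sq s m ^ (j + 1))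
    (bound := fun _ => Real.exp (|η| + 1)) (Metric.ball_mem_nhds η one_pos)
    (Eventually.of_forall fun t => Continuous.aestronglyMeasurable (by fun_prop))
    (integrable_of_continuous (by fun_prop)) (Continuous.aestronglyMeasurable (by fun_prop))
    (Eventually.of_forall fun m t ht => ?_) (integrable_const _)
    (Eventually.of_forall fun m t ht => ?_)).2
  · have h0 := sq_nonneg' s m
    have h1 := sq_le_one s m
    rw [Real.norm_eq_abs, abs_of_nonneg (by positivity)]
    rw [Metric.mem_ball, Real.dist_eq] at ht
    have h2 : t * sq s m ≤ |η| + 1 := by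
      have h3 : t ≤ |η| + 1 := by linarith [le_abs_self (t - η), le_abs_self η]
      have h4 : 0 ≤ |η| + 1 := by positivity
      nlinarith
    calc Real.exp (t * sq s m) * sq s m ^ (j + 1) ≤ Real.exp (|η| + 1) * 1 :=
          mul_le_mul (Real.exp_le_exp.2 h2) (pow_le_one₀ h0 h1) (by positivity)
            (Real.exp_pos _).le
      _ = _ := mul_one _
  · have h := (((hasDerivAt_id t).mul_const (sq s m)).exp).mul_const (sq s m ^ j)
    refine h.congr_deriv ?_
    simp
    ring

lemma mom_eq_div (s : Finset (Fin n)) (η : ℝ) (j : ℕ) :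
    mom s η j = (∫ m, Real.exp (η * sq s m) * sq s m ^ j ∂(surf n)) /
      ∫ m, Real.exp (η * sq s m) * sq s m ^ 0 ∂(surf n) := by
  unfold mom dens
  rw [← integral_div]
  simp_rw [div_mul_eq_mul_div, pow_zero, mul_one]

/-- In an exponential family the derivative of a mean is the covariance with `u`; for `j = 1` it is
the variance. -/
lemma hasDerivAt_mom [NeZero n] (s : Finset (Fin n)) (j : ℕ) (η : ℝ) :
    HasDerivAt (fun η => mom s η j) (mom s η (j + 1) - mom s η j * mom s η 1) η := by
  have h0 : (∫ m, Real.exp (η * sq s m) * sq s m ^ 0 ∂(surf n)) ≠ 0 := by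
    simpa using (integral_exp_sq_pos s η).ne'
  simp_rw [mom_eq_div]
  refine ((hasDerivAt_integral_exp_sq s j η).fun_div (hasDerivAt_integral_exp_sq s 0 η)
    h0).congr_deriv ?_
  simp only [zero_add]
  generalize ∫ m, Real.exp (η * sq s m) * sq s m ^ 0 ∂(surf n) = Z at h0 ⊢
  field_simp

/-- A solution of the equation `2 η y' + (n + 4) y = n (1 - 2 e) e'` with increasing `e` is
positive as long as `e ≤ 1 / 2`. -/
lemma pos_of_le_half {n : ℕ} {e V y w : ℝ → ℝ} (he : StrictMono e) (he0 : e 0 < 1 / 2)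
    (hn : 0 < (n : ℝ)) (hV : ∀ x, 0 < V x) (hy : ∀ x, HasDerivAt y (w x) x)
    (hode : ∀ x, (n + 4) * y x + 2 * x * w x = n * ((1 - 2 * e x) * V x)) {x : ℝ}
    (hx : e x ≤ 1 / 2) : 0 < y x := by
  rcases eq_or_ne x 0 with rfl | hx0
  · have h := hode 0
    have h1 : 0 < n * ((1 - 2 * e 0) * V 0) := mul_pos hn (mul_pos (by linarith) (hV 0))
    nlinarith
  -- The substitution `x = ± t²` gives the equation the integrating factor `t^(n+4)`, an integer
  -- power, on both sides of the singular point `0`.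
  obtain ⟨ε, hε, t₀, ht₀, rfl⟩ : ∃ ε : ℝ, (ε = 1 ∨ ε = -1) ∧ ∃ t > 0, x = ε * t ^ 2 := by
    rcases lt_or_gt_of_ne hx0 with h | h
    · exact ⟨-1, Or.inr rfl, √(-x), Real.sqrt_pos.2 (by linarith), by
        rw [Real.sq_sqrt (by linarith)]; ring⟩
    · exact ⟨1, Or.inl rfl, √x, Real.sqrt_pos.2 h, by rw [Real.sq_sqrt h.le]; ring⟩
  have hY : ∀ t, HasDerivAt (fun t => t ^ (n + 4) * y (ε * t ^ 2))
      (t ^ (n + 3) * (n * ((1 - 2 * e (ε * t ^ 2)) * V (ε * t ^ 2)))) t := by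
    intro t
    have h1 : HasDerivAt (fun t : ℝ => ε * t ^ 2) (ε * (2 * t)) t := by
      simpa using (hasDerivAt_pow 2 t).const_mul ε
    have h2 := (hasDerivAt_pow (n + 4) t).fun_mul (HasDerivAt.comp t (hy (ε * t ^ 2)) h1)
    refine h2.congr_deriv ?_
    simp only [Function.comp, Nat.add_succ_sub_one]
    push_cast
    linear_combination t ^ (n + 3) * hode (ε * t ^ 2)
  have hmono : StrictMonoOn (fun t => t ^ (n + 4) * y (ε * t ^ 2)) (Set.Icc 0 t₀) := by
    refine strictMonoOn_of_deriv_pos (convex_Icc _ _)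
      (fun t _ => (hY t).continuousAt.continuousWithinAt) fun t ht => ?_
    rw [interior_Icc] at ht
    rw [(hY t).deriv]
    have hlt : e (ε * t ^ 2) < 1 / 2 := by
      rcases hε with rfl | rfl
      · refine lt_of_lt_of_le (he ?_) hx
        nlinarith [ht.1, ht.2]
      · refine lt_trans (he ?_) he0
        nlinarith [ht.1]
    exact mul_pos (pow_pos ht.1 _) (mul_pos hn (mul_pos (by linarith) (hV _)))
  have h := hmono ⟨le_rfl, ht₀.le⟩ ⟨ht₀.le, le_rfl⟩ ht₀
  simp only [zero_pow (Nat.succ_ne_zero _), zero_mul] at h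
  exact pos_of_mul_pos_right h (pow_nonneg ht₀.le _)

/-- Once `e` exceeds `1 / 2` the right side of the equation is negative, so `t^(n+4) y(t²)`
decreases and cannot become nonnegative again. -/
lemma neg_of_half_le {n : ℕ} {e V y w : ℝ → ℝ} (he : StrictMono e)
    (hn : 0 < (n : ℝ)) (hV : ∀ x, 0 < V x) (hy : ∀ x, HasDerivAt y (w x) x)
    (hode : ∀ x, (n + 4) * y x + 2 * x * w x = n * ((1 - 2 * e x) * V x)) {x z : ℝ}
    (hx0 : 0 ≤ x) (hx : 1 / 2 ≤ e x) (hyx : y x ≤ 0) (hxz : x < z) : y z < 0 := by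
  have hY : ∀ t, HasDerivAt (fun t => t ^ (n + 4) * y (t ^ 2))
      (t ^ (n + 3) * (n * ((1 - 2 * e (t ^ 2)) * V (t ^ 2)))) t := by
    intro t
    have h1 : HasDerivAt (fun t : ℝ => t ^ 2) (2 * t) t := by
      simpa using hasDerivAt_pow 2 t
    have h2 := (hasDerivAt_pow (n + 4) t).fun_mul (HasDerivAt.comp t (hy (t ^ 2)) h1)
    refine h2.congr_deriv ?_
    simp only [Function.comp, Nat.add_succ_sub_one]
    push_cast
    linear_combination t ^ (n + 3) * hode (t ^ 2)
  have hlt : √x < √z := Real.sqrt_lt_sqrt hx0 hxz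
  have hanti : StrictAntiOn (fun t => t ^ (n + 4) * y (t ^ 2)) (Set.Icc (√x) (√z)) := by
    refine strictAntiOn_of_deriv_neg (convex_Icc _ _)
      (fun t _ => (hY t).continuousAt.continuousWithinAt) fun t ht => ?_
    rw [interior_Icc] at ht
    rw [(hY t).deriv]
    have ht0 : 0 < t := (Real.sqrt_nonneg x).trans_lt ht.1
    have hgt : 1 / 2 < e (t ^ 2) := hx.trans_lt (he ((Real.sqrt_lt' ht0).1 ht.1))
    exact mul_neg_of_pos_of_neg (pow_pos ht0 _)
      (mul_neg_of_pos_of_neg hn (mul_neg_of_neg_of_pos (by linarith) (hV _)))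
  have h := hanti ⟨le_rfl, hlt.le⟩ ⟨hlt.le, le_rfl⟩ hlt
  simp only [Real.sq_sqrt hx0, Real.sq_sqrt (hx0.trans hxz.le)] at h
  have h3 : √x ^ (n + 4) * y x ≤ 0 := mul_nonpos_of_nonneg_of_nonpos (by positivity) hyx
  by_contra! h4
  have : 0 ≤ √z ^ (n + 4) * y z := by positivity
  linarith

/-- The function `p = (n e - 1) / (2 η)`, where `e' = e - e² - p`, increases up to some point and
decreases from there on. -/
lemma exists_unimodal {n : ℕ} (hn : 3 ≤ n) {e V p y w : ℝ → ℝ} (he : ∀ x, HasDerivAt e (V x) x)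
    (hp : ∀ x, HasDerivAt p (y x) x) (hy : ∀ x, HasDerivAt y (w x) x) (hV : ∀ x, 0 < V x)
    (hp0 : ∀ x, 0 < p x) (he1 : ∀ x, e x ≤ 1) (hric : ∀ x, V x = e x - e x ^ 2 - p x)
    (hI : ∀ x, n * e x - 1 = 2 * x * p x) :
    ∃ ηs : ℝ, 0 ≤ ηs ∧ (∀ x < ηs, 0 < y x) ∧ ∀ x > ηs, y x < 0 := by
  have hn' : (3 : ℝ) ≤ n := by exact_mod_cast hn
  have hmono : StrictMono e := strictMono_of_hasDerivAt_pos he hV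
  have hI1 : ∀ x, n * V x = 2 * p x + 2 * x * y x := by
    intro x
    have d1 : HasDerivAt (fun x => n * e x - 1) (n * V x) x := ((he x).const_mul _).sub_const 1
    have d2 : HasDerivAt (fun x => 2 * x * p x) (2 * 1 * p x + 2 * x * y x) x :=
      ((hasDerivAt_id x).const_mul 2).fun_mul (hp x)
    rw [funext hI] at d1
    rw [d1.unique d2, mul_one]
  have hV' : ∀ x, HasDerivAt V ((1 - 2 * e x) * V x - y x) x := by
    intro x
    have d := ((he x).fun_sub ((he x).fun_pow 2)).fun_sub (hp x)
    rw [← funext hric] at d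
    refine d.congr_deriv ?_
    push_cast
    ring
  -- Differentiate `n e - 1 = 2 x p` twice and eliminate `V'` with the derivative of `V = e - e² -
  -- p`.
  have hode : ∀ x, (n + 4) * y x + 2 * x * w x = n * ((1 - 2 * e x) * V x) := by
    intro x
    have d1 : HasDerivAt (fun x => n * V x) (n * ((1 - 2 * e x) * V x - y x)) x :=
      (hV' x).const_mul _
    have d2 : HasDerivAt (fun x => 2 * p x + 2 * x * y x)
        (2 * y x + (2 * 1 * y x + 2 * x * w x)) x :=
      ((hp x).const_mul 2).fun_add (((hasDerivAt_id x).const_mul 2).fun_mul (hy x))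
    rw [funext hI1] at d1
    have := d1.unique d2
    linarith
  have he0 : e 0 < 1 / 2 := by
    have := hI 0
    nlinarith
  have hpos : ∀ {x}, e x ≤ 1 / 2 → 0 < y x :=
    fun hx => pos_of_le_half hmono he0 (by linarith) hV hy hode hx
  have hexists : ∃ x, y x ≤ 0 := by
    by_contra! h
    have hpm : StrictMono p := strictMono_of_hasDerivAt_pos hp h
    -- If `p` increased forever, then `n e - 1 = 2 x p` would be at least `2 n` at this point,
    -- against `e ≤ 1`.
    set z := max 1 (n / p 1) with hz
    have h1 : p 1 ≤ p z := hpm.monotone (le_max_left _ _)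
    have h2 : n ≤ z * p 1 := by
      rw [← div_le_iff₀ (hp0 1)]
      exact le_max_right _ _
    have h3 := hI z
    have h4 : 1 ≤ z := le_max_left _ _
    nlinarith [he1 z, mul_le_mul_of_nonneg_left h1 (by linarith : 0 ≤ z)]
  have hlow : ∀ x, y x ≤ 0 → 0 < x := by
    intro x hx
    by_contra! h
    have := hpos ((hmono.monotone h).trans he0.le)
    linarith
  have hbdd : BddBelow {x | y x ≤ 0} := ⟨0, fun x hx => (hlow x hx).le⟩
  refine ⟨sInf {x | y x ≤ 0}, le_csInf hexists fun x hx => (hlow x hx).le, fun x hx => ?_,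
    fun x hx => ?_⟩
  · by_contra! h
    exact absurd (csInf_le hbdd h) (not_le.2 hx)
  · obtain ⟨a, ha, hax⟩ := exists_lt_of_csInf_lt hexists hx
    have hae : 1 / 2 ≤ e a := by
      by_contra! h
      have := hpos h.le
      exact absurd ha (not_le.2 this)
    exact neg_of_half_le hmono (by linarith) hV hy hode (hlow a ha).le hae ha hax

/-! ### From coordinate blocks to the densities of the theorem. -/

/-- The first `k` coordinates. -/
def lowCoords (n k : ℕ) : Finset (Fin n) := Finset.univ.filter fun i => (i : ℕ) < k

lemma card_lowCoords {k : ℕ} (hk : k ≤ n) : (lowCoords n k).card = k := by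
  rw [lowCoords, Fin.card_filter_val_lt, min_eq_right hk]

lemma lowCoords_one [NeZero n] : lowCoords n 1 = {0} := by
  ext i
  simp [lowCoords]

lemma norm_proj_sq (k : ℕ) (m : Sph n) :
    ‖proj k (m : EuclideanSpace ℝ (Fin n))‖ ^ 2 = sq (lowCoords n k) m := by
  rw [EuclideanSpace.real_norm_sq_eq, sq, lowCoords, Finset.sum_filter]
  refine Finset.sum_congr rfl fun i _ => ?_
  simp only [proj]
  split_ifs <;> simp [crd]

lemma h_eq (k : ℕ) (η : ℝ) (R : EuclideanSpace ℝ (Fin n) ≃ₗᵢ[ℝ] EuclideanSpace ℝ (Fin n)) :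
    h n k η R = fun m => dens (lowCoords n k) η (sphHomeo R m) := by
  funext m
  unfold h dens
  simp_rw [← sphHomeo_coe, norm_proj_sq]
  rw [integral_sphHomeo R fun m => Real.exp (η * sq (lowCoords n k) m)]

lemma rotInv_uniform : RotInv Finset.univ (h₀ n) := rotInv_const _ _

lemma surf_real_univ_pos [NeZero n] : 0 < (surf n).real Set.univ :=
  ENNReal.toReal_pos (Measure.measure_univ_ne_zero.2 (NeZero.ne _)) (measure_ne_top _ _)

lemma integral_uniform [NeZero n] : ∫ m, h₀ n m ∂(surf n) = 1 := by
  unfold h₀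
  rw [integral_const, smul_eq_mul, mul_one_div_cancel surf_real_univ_pos.ne']

lemma isCriticalPoint_uniform [NeZero n] (α : ℝ) : IsCriticalPoint n α (h₀ n) := by
  refine ⟨fun m => one_div_pos.2 surf_real_univ_pos, integral_uniform,
    Real.log (1 / (surf n).real Set.univ) - α * (1 / n), fun m => ?_⟩
  have hn : (n : ℝ) ≠ 0 := Nat.cast_ne_zero.2 (NeZero.ne n)
  rw [integral_dotSq_mul (integrable_of_continuous rotInv_uniform.1)]
  have e : ∀ a b : Fin n, ∫ m, crd a m * crd b m * h₀ n m ∂(surf n) =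
      if a = b then 1 / (n : ℝ) else 0 := by
    intro a b
    have h := rotInv_uniform.integral_crd_two (Finset.mem_univ a) (Finset.mem_univ b)
    simp_rw [sq_univ, mul_one, integral_uniform, mul_one, Finset.card_univ, Fintype.card_fin] at h
    simp_rw [mul_comm _ (h₀ n _)]
    rw [← mul_right_inj' hn, h]
    simp only [kd, eq_comm (a := b)]
    split_ifs
    · field_simp
    · simp
  have e2 : ∑ a, crd a m * crd a m * (1 / (n : ℝ)) = 1 / n := by
    rw [← Finset.sum_mul]
    simp_rw [← pow_two]
    rw [show ∑ i, crd i m ^ 2 = 1 from sq_univ m, one_mul]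
  simp_rw [e, mul_ite, mul_zero, Finset.sum_ite_eq, Finset.mem_univ, if_true, e2]
  rfl

/-- For the uniform density the whole coordinate set is one block, and every traceless form has mean
square `2 ∑ M_ab² / (n (n + 2))`; the direction `m_a m_b` in `isUnstable_uniform` shows that the
resulting bound is sharp. -/
lemma isStable_uniform [NeZero n] {α : ℝ} (hα : 0 ≤ α) (h : α ≤ n * (n + 2) / 2) :
    IsStable n α (h₀ n) := by
  have hn : (0 : ℝ) < n := Nat.cast_pos.2 (NeZero.pos n)
  refine isStable_of_quad_bound hα rotInv_uniform.1 (isCriticalPoint_uniform α)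
    fun M hM htr => ⟨0, ?_⟩
  have h1 := rotInv_uniform.integral_quadOn_sq hM htr
  simp_rw [sq_univ, one_pow, mul_one, integral_uniform, mul_one, Finset.card_univ,
    Fintype.card_fin] at h1
  simp_rw [sub_zero]
  change α * ∫ m, h₀ n m * quadOn Finset.univ M m ^ 2 ∂(surf n) ≤ _
  set S := ∑ a, ∑ b, M a b ^ 2
  have hS : 0 ≤ S := Finset.sum_nonneg fun _ _ => Finset.sum_nonneg fun _ _ => sq_nonneg _
  refine le_of_mul_le_mul_left ?_ (show (0 : ℝ) < n * (n + 2) by positivity)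
  rw [mul_left_comm, h1]
  nlinarith [mul_le_mul_of_nonneg_right h hS]

lemma isUnstable_uniform (hn : 2 ≤ n) [NeZero n] {α : ℝ} (h : n * (n + 2) / 2 < α) :
    IsUnstable n α (h₀ n) := by
  have hn' : (0 : ℝ) < n := Nat.cast_pos.2 (NeZero.pos n)
  have hα0 : 0 < α := lt_trans (by positivity) h
  let a : Fin n := ⟨0, by omega⟩
  let b : Fin n := ⟨1, by omega⟩
  have hab : a ≠ b := by simp [a, b]
  have ha := Finset.mem_univ a
  have hb := Finset.mem_univ b
  have h0 : ∫ m, h₀ n m * (crd a m * crd b m) ∂(surf n) = 0 := by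
    have h2 := rotInv_uniform.integral_crd_two ha hb
    simp only [kd, hab.symm, if_false, zero_mul, mul_eq_zero] at h2
    exact h2.resolve_left (by simpa using NeZero.ne n)
  have h4 := rotInv_uniform.integral_crd_four ha hb ha hb
  have hk : kd b a * kd b a + kd a a * kd b b + kd b a * kd a b = 1 := by
    simp [kd, hab.symm]
  rw [hk, one_mul] at h4
  simp_rw [sq_univ, one_pow, mul_one, integral_uniform, Finset.card_univ, Fintype.card_fin] at h4
  set c := ∫ m, h₀ n m * (crd a m * (crd b m * (crd a m * crd b m))) ∂(surf n) with hc
  refine isUnstable_of_direction hα0.le rotInv_uniform.1 (isCriticalPoint_uniform α)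
    (by fun_prop) h0 {(a, b), (b, a)} ?_
  have e1 : ∀ m, h₀ n m * (crd a m * crd b m) ^ 2 =
      h₀ n m * (crd a m * (crd b m * (crd a m * crd b m))) := fun m => by ring
  have e2 : ∀ m, h₀ n m * (crd a m * crd b m * (crd a m * crd b m)) =
      h₀ n m * (crd a m * (crd b m * (crd a m * crd b m))) := fun m => by ring
  have e3 : ∀ m, h₀ n m * (crd b m * crd a m * (crd a m * crd b m)) =
      h₀ n m * (crd a m * (crd b m * (crd a m * crd b m))) := fun m => by ring
  rw [Finset.sum_pair (by simp [hab])]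
  simp_rw [e1, e2, e3, ← hc]
  have hc1 : c = 1 / (n * (n + 2)) := by
    rw [eq_div_iff (by positivity), mul_comm, h4]
  have h5 : 1 < 2 * α * c := by
    rw [hc1, mul_one_div, one_lt_div (by positivity)]
    linarith
  have hcpos : 0 < c := by rw [hc1]; positivity
  nlinarith

lemma uniform_stable_iff (hn : 2 ≤ n) [NeZero n] {α : ℝ} (hα : 0 < α) :
    IsStable n α (h₀ n) ↔ α ≤ n * (n + 2) / 2 :=
  ⟨fun h => by
    by_contra! h'
    exact (isUnstable_uniform hn h').2 h, isStable_uniform hα.le⟩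

lemma lowCoords_nonempty_compl {k : ℕ} (hk : 1 ≤ k) (hkn : k < n) :
    (lowCoords n k).Nonempty ∧ (lowCoords n k)ᶜ.Nonempty := by
  constructor
  · exact ⟨⟨0, by omega⟩, by simp [lowCoords]; omega⟩
  · exact ⟨⟨k, hkn⟩, by simp [lowCoords]⟩

lemma two_mul_sigma_mul [NeZero n] {k : ℕ} (hk : 1 ≤ k) (hkn : k < n) (η : ℝ) :
    2 * sigma n k η * (mom (lowCoords n k) η 1 - mom (lowCoords n k) η 2) =
      (lowCoords n k).card * (n - (lowCoords n k).card) := by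
  obtain ⟨⟨a, ha⟩, ⟨b, hb⟩⟩ := lowCoords_nonempty_compl hk hkn
  have hp := sub_pos.2 (mom_strictAnti ha (Finset.mem_compl.1 hb) η 1)
  simp only [Nat.reduceAdd] at hp
  rw [sigma_eq (lowCoords n k) k hk hkn (card_lowCoords hkn.le), card_lowCoords hkn.le]
  field_simp

lemma mom_compl_sub [NeZero n] (s : Finset (Fin n)) (η : ℝ) :
    mom sᶜ (-η) 1 - mom sᶜ (-η) 2 = mom s η 1 - mom s η 2 := by
  have h1 := integral_dens_mul_linear sᶜ (-η) 1 (-1) 1 2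
  have h2 := integral_dens_mul_linear s η 1 (-1) 1 2
  have e : ∀ m, dens sᶜ (-η) m * (1 * sq sᶜ m ^ 1 + (-1) * sq sᶜ m ^ 2) =
      dens s η m * (1 * sq s m ^ 1 + (-1) * sq s m ^ 2) := fun m => by
    rw [dens_compl, sq_compl]; ring
  simp_rw [e] at h1
  linarith

lemma isUnstable_dens_of_neg [NeZero n] {s : Finset (Fin n)} {η α : ℝ} (hη : η < 0)
    (hs : s.Nonempty) (hs' : 2 ≤ sᶜ.card)
    (hα : 2 * α * (mom s η 1 - mom s η 2) = s.card * (n - s.card)) :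
    IsUnstable n α (dens s η) := by
  rw [← dens_compl]
  refine isUnstable_dens_of_pos (neg_pos.2 hη) hs' (by rwa [compl_compl]) ?_
  rw [mom_compl_sub, hα, card_compl_cast]
  ring

lemma isUnstable_h [NeZero n] {k : ℕ} {η : ℝ} (hk : 2 ≤ k) (hkn : k ≤ n / 2) (hη : η ≠ 0)
    (R : EuclideanSpace ℝ (Fin n) ≃ₗᵢ[ℝ] EuclideanSpace ℝ (Fin n)) :
    IsUnstable n (sigma n k η) (h n k η R) := by
  have hlt : k < n := by omega
  obtain ⟨h1, h2⟩ := lowCoords_nonempty_compl (by omega : 1 ≤ k) hlt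
  have hα := two_mul_sigma_mul (by omega : 1 ≤ k) hlt η
  have hc := card_lowCoords hlt.le
  rw [h_eq]
  refine IsUnstable.comp_sphHomeo ?_ R
  -- Since `2 ≤ k ≤ n / 2`, the block and its complement both have two coordinates, so either sign
  -- of `η` has an unstable direction.
  rcases lt_or_gt_of_ne hη with h | h
  · refine isUnstable_dens_of_neg h h1 ?_ hα
    rw [Finset.card_compl, hc, Fintype.card_fin]
    omega
  · exact isUnstable_dens_of_pos h (by rw [hc]; exact hk) h2 hα

/-- Differentiating `n E u - 1 = 2 η p` gives `n V - 2 p = 2 η p'`. For `η > 0` the stability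
criterion is therefore the sign of `p'`, which `exists_unimodal` determines. -/
lemma exists_unimodal_mom [NeZero n] (hn : 3 ≤ n) (s : Finset (Fin n)) (hs : s.card = 1) :
    ∃ ηs : ℝ, 0 ≤ ηs ∧
      (∀ η, η ≠ ηs → mom s η 1 - mom s η 2 < mom s ηs 1 - mom s ηs 2) ∧
      (∀ η, 0 < η → η < ηs →
        2 * (mom s η 1 - mom s η 2) < n * (mom s η 2 - mom s η 1 ^ 2)) ∧
      ∀ η, ηs < η → n * (mom s η 2 - mom s η 1 ^ 2) ≤ 2 * (mom s η 1 - mom s η 2) := by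
  obtain ⟨a, ha⟩ := Finset.card_pos.1 (by omega : 0 < s.card)
  obtain ⟨b, hb⟩ : sᶜ.Nonempty := Finset.card_pos.1 (by
    rw [Finset.card_compl, hs, Fintype.card_fin]; omega)
  replace hb := Finset.mem_compl.1 hb
  have hI : ∀ η, n * mom s η 1 - 1 = 2 * η * (mom s η 1 - mom s η 2) := fun η => by
    have h := mom_recursion s η 0
    rw [mom_zero, hs] at h
    norm_num at h
    exact h
  set p : ℝ → ℝ := fun η => mom s η 1 - mom s η 2
  set V : ℝ → ℝ := fun η => mom s η 2 - mom s η 1 ^ 2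
  set y : ℝ → ℝ := fun η => (mom s η 2 - mom s η 1 * mom s η 1) -
    (mom s η 3 - mom s η 2 * mom s η 1)
  have d1 := hasDerivAt_mom s 1
  have d2 := hasDerivAt_mom s 2
  have d3 := hasDerivAt_mom s 3
  have he : ∀ η, HasDerivAt (fun η => mom s η 1) (V η) η := fun η =>
    (d1 η).congr_deriv (by simp only [V]; ring)
  have hp : ∀ η, HasDerivAt p (y η) η := fun η => (d1 η).fun_sub (d2 η)
  have hy : ∀ η, HasDerivAt y _ η := fun η =>
    ((d2 η).fun_sub ((d1 η).fun_mul (d1 η))).fun_sub ((d3 η).fun_sub ((d2 η).fun_mul (d1 η)))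
  have hp0 : ∀ η, 0 < p η := fun η => sub_pos.2 (mom_strictAnti ha hb η 1)
  have he1 : ∀ η, mom s η 1 ≤ 1 := fun η => by
    rw [← mom_zero s η]
    exact (mom_strictAnti ha hb η 0).le
  obtain ⟨ηs, h0, h1, h2⟩ := exists_unimodal hn he hp hy (mom_variance_pos ha hb) hp0 he1
    (fun η => by simp only [V, p]; ring) hI
  have hid : ∀ η, n * V η = 2 * p η + 2 * η * y η := by
    intro η
    have e1 : HasDerivAt (fun η => n * mom s η 1 - 1) (n * V η) η :=
      ((he η).const_mul _).sub_const 1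
    have e2 : HasDerivAt (fun η => 2 * η * p η) (2 * 1 * p η + 2 * η * y η) η :=
      ((hasDerivAt_id η).const_mul 2).fun_mul (hp η)
    rw [funext hI] at e1
    rw [e1.unique e2, mul_one]
  refine ⟨ηs, h0, fun η hη => ?_, fun η hη0 hη => ?_, fun η hη => ?_⟩
  · rcases lt_or_gt_of_ne hη with h | h
    · refine strictMonoOn_of_deriv_pos (convex_Iic ηs) (f := p)
        (fun t _ => (hp t).continuousAt.continuousWithinAt) (fun t ht => ?_) h.le
        (Set.mem_Iic.2 le_rfl) h
      rw [interior_Iic] at ht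
      rw [(hp t).deriv]
      exact h1 t ht
    · refine strictAntiOn_of_deriv_neg (convex_Ici ηs) (f := p)
        (fun t _ => (hp t).continuousAt.continuousWithinAt) (fun t ht => ?_)
        (Set.mem_Ici.2 le_rfl) (Set.mem_Ici.2 h.le) h
      rw [interior_Ici] at ht
      rw [(hp t).deriv]
      exact h2 t ht
  · have := mul_pos hη0 (h1 η hη)
    have := hid η
    change 2 * p η < n * V η
    linarith
  · have := mul_neg_of_pos_of_neg (h0.trans_lt hη) (h2 η hη)
    have := hid η
    change n * V η ≤ 2 * p η
    linarith

/-- As `σ_1` is a positive constant over `p`, its minimum is the maximum of `p`. Below the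
threshold, negative `η` is unstable through the complementary block and positive `η` through the
direction `u - E u`. -/
lemma axisymmetric_stability [NeZero n] (hn : 3 ≤ n) : ∃ ηs : ℝ,
    (∀ η : ℝ, η ≠ ηs → sigma n 1 ηs < sigma n 1 η) ∧
    ∀ (η : ℝ) (R : EuclideanSpace ℝ (Fin n) ≃ₗᵢ[ℝ] EuclideanSpace ℝ (Fin n)), η ≠ 0 →
      (ηs < η → IsStable n (sigma n 1 η) (h n 1 η R)) ∧
      (η < ηs → IsUnstable n (sigma n 1 η) (h n 1 η R)) := by
  have hlt : 1 < n := by omega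
  have hn' : (3 : ℝ) ≤ n := by exact_mod_cast hn
  have hc := card_lowCoords hlt.le
  obtain ⟨h1, h2⟩ := lowCoords_nonempty_compl le_rfl hlt
  have hcc : 2 ≤ (lowCoords n 1)ᶜ.card := by
    rw [Finset.card_compl, hc, Fintype.card_fin]
    omega
  obtain ⟨ηs, h0, hmax, hun, hst⟩ := exists_unimodal_mom hn (lowCoords n 1) hc
  refine ⟨ηs, fun η hη => ?_, fun η R hη => ⟨fun h => ?_, fun h => ?_⟩⟩
  · obtain ⟨a, ha⟩ := h1
    obtain ⟨b, hb⟩ := h2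
    have hp := sub_pos.2 (mom_strictAnti ha (Finset.mem_compl.1 hb) η 1)
    simp only [Nat.reduceAdd] at hp
    rw [sigma_eq (lowCoords n 1) 1 le_rfl hlt hc, sigma_eq (lowCoords n 1) 1 le_rfl hlt hc]
    push_cast
    exact div_lt_div_of_pos_left (by linarith) (by linarith) (by linarith [hmax η hη])
  · rw [h_eq]
    refine IsStable.comp_sphHomeo ?_ R
    have hα := two_mul_sigma_mul le_rfl hlt η
    have hV := hst η h
    rw [hc] at hα
    rw [lowCoords_one] at *
    refine isStable_dens_singleton hn 0 (h0.trans_lt h) ?_ hV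
    rw [hα]
    push_cast
    ring
  · rw [h_eq]
    refine IsUnstable.comp_sphHomeo ?_ R
    have hα := two_mul_sigma_mul le_rfl hlt η
    rcases lt_or_gt_of_ne hη with hneg | hpos
    · exact isUnstable_dens_of_neg hneg h1 hcc hα
    · exact isUnstable_dens_of_variance h1 h2 (Or.inr hcc) hα (hun η hpos h)

end Onsager

end

theorem theorem1p1 (n : ℕ) (hn : 2 ≤ n) :
    (∀ α : ℝ, 0 < α →
      Onsager.IsCriticalPoint n α (Onsager.h₀ n) ∧
      (Onsager.IsStable n α (Onsager.h₀ n) ↔ α ≤ (n : ℝ) * (n + 2) / 2)) ∧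
    (∀ (k : ℕ) (α η : ℝ)
      (R : EuclideanSpace ℝ (Fin n) ≃ₗᵢ[ℝ] EuclideanSpace ℝ (Fin n)),
      2 ≤ k → k ≤ n / 2 → η ≠ 0 → α = Onsager.sigma n k η →
        Onsager.IsUnstable n α (Onsager.h n k η R)) ∧
    (3 ≤ n → ∃ ηs : ℝ,
      (∀ η : ℝ, η ≠ ηs → Onsager.sigma n 1 ηs < Onsager.sigma n 1 η) ∧
      ∀ (α η : ℝ) (R : EuclideanSpace ℝ (Fin n) ≃ₗᵢ[ℝ] EuclideanSpace ℝ (Fin n)),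
        η ≠ 0 → α = Onsager.sigma n 1 η →
          (ηs < η → Onsager.IsStable n α (Onsager.h n 1 η R)) ∧
          (η < ηs → Onsager.IsUnstable n α (Onsager.h n 1 η R))) := by
  have : NeZero n := ⟨by omega⟩
  refine ⟨fun α hα => ⟨Onsager.isCriticalPoint_uniform α, Onsager.uniform_stable_iff hn hα⟩,
    fun k α η R hk hkn hη hα => hα ▸ Onsager.isUnstable_h hk hkn hη R, fun hn3 => ?_⟩
  obtain ⟨ηs, h1, h2⟩ := Onsager.axisymmetric_stability hn3
  exact ⟨ηs, h1, fun α η R hη hα => hα ▸ h2 η R hη⟩
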